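/- For a real signal $x\in\mathbb{R}^n$ and sampling vectors $a_1,\dots,a_m\in\mathbb{C}^n$ put $y_r=|a_r^*x|^2$, and for $z\in\mathbb{R}^n$ let $$f(z)=\frac1{2m}\sum_{r=1}^m\bigl(|a_r^*z|^2-y_r\bigr)^2,\qquad \nabla^2 f(z)=\frac1m\sum_{r=1}^m\mathrm{Re}\Bigl((2|a_r^*z|^2-y_r)\,a_ra_r^*+(a_r^*z)^2\,a_ra_r^T\Bigr)$$ be the least-squares cost and its Hessian matrix (normalized by the factor $1/2$), and let $\mathrm{dist}(z,x)=\min\{\|z-x\|,\|z+x\|\}$. There are absolute constants $C,\gamma>0$ such that the following holds. Let $m,n\ge 1$ satisfy $m\ge C\,n\log n$, let $x\in\mathbb{R}^n$, and let $a_1,\dots,a_m$ be independent random vectors with distribution $N(0,I/2)+i\,N(0,I/2)$ on $\mathbb{C}^n$. Put $\alpha=\gamma\min\{m/n^2,\sqrt m/n\}$. Then, with probability at least $1-e^{-\alpha n}$, the inequality $$w^T\nabla^2 f(z)\,w\ge 0$$ holds simultaneously for all $z\in\mathbb{R}^n$ with $\mathrm{dist}(z,x)\le\|x\|/24$ and all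 $w\in\mathbb{R}^n$ with $\|w\|=1$, and $f$ is convex on each of the two closed balls of radius $\|x\|/24$ centred at $x$ and at $-x$. -/

import Mathlib

open MeasureTheory ProbabilityTheory
open scoped Matrix ComplexConjugate

noncomputable section

namespace PhaseRetrieval

/-- The law on `ℂ` of `ξ + i η` with `ξ, η` independent real Gaussians `N(0, 1/2)`. -/
def complexGaussian : Measure ℂ :=
  ((gaussianReal 0 (1 / 2)).prod (gaussianReal 0 (1 / 2))).map
    Complex.measurableEquivRealProd.symm

/-- The law `N(0, I/2) + i N(0, I/2)` on `ℂⁿ`. -/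
def complexGaussianVector (n : ℕ) : Measure (Fin n → ℂ) :=
  Measure.pi fun _ => complexGaussian

/-- The Gaussian model: the sampling vectors `a 0, …, a (m - 1)` are independent random vectors
with law `N(0, I/2) + i N(0, I/2)` on `ℂⁿ`. -/
structure IsGaussianModel {Ω : Type*} [MeasurableSpace Ω] {m n : ℕ}
    (a : Fin m → Ω → Fin n → ℂ) (P : Measure Ω) : Prop where
  law : ∀ r, HasLaw (a r) (complexGaussianVector n) P
  indep : iIndepFun a P

/-- The linear measurement `aᵣ* z` of a real signal `z`. -/
def sample {n : ℕ} (a : Fin n → ℂ) (z : EuclideanSpace ℝ (Fin n)) : ℂ :=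
  ∑ j, conj (a j) * (z j : ℂ)

/-- The phaseless data `yᵣ = |aᵣ* x|²`. -/
def intensity {m n : ℕ} (a : Fin m → Fin n → ℂ) (x : EuclideanSpace ℝ (Fin n)) : Fin m → ℝ :=
  fun r => ‖sample (a r) x‖ ^ 2

/-- The least-squares cost `f(z) = (1 / 2m) ∑ᵣ (|aᵣ* z|² - yᵣ)²`. -/
def cost {m n : ℕ} (a : Fin m → Fin n → ℂ) (y : Fin m → ℝ) (z : EuclideanSpace ℝ (Fin n)) : ℝ :=
  1 / (2 * (m : ℝ)) * ∑ r, (‖sample (a r) z‖ ^ 2 - y r) ^ 2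

/-- The Hessian matrix of the cost at a real point,
`∇²f(z) = (1/m) ∑ᵣ Re ((2 |aᵣ* z|² - yᵣ) aᵣ aᵣ* + (aᵣ* z)² aᵣ aᵣᵀ)`,
normalized with the factor `1/2` (see `iteratedDeriv_two_cost`). -/
def hessian {m n : ℕ} (a : Fin m → Fin n → ℂ) (y : Fin m → ℝ) (z : EuclideanSpace ℝ (Fin n)) :
    Matrix (Fin n) (Fin n) ℝ :=
  Matrix.of fun j k => 1 / (m : ℝ) * ∑ r,
    (((2 * ‖sample (a r) z‖ ^ 2 - y r : ℝ) : ℂ) * (a r j * conj (a r k))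
      + sample (a r) z ^ 2 * (a r j * a r k)).re

/-- The distance from `z` to the set `{x, -x}` of real solutions. -/
def signDist {n : ℕ} (z x : EuclideanSpace ℝ (Fin n)) : ℝ :=
  min ‖z - x‖ ‖z + x‖

theorem quadForm_hessian {m n : ℕ} (a : Fin m → Fin n → ℂ) (y : Fin m → ℝ)
    (z w : EuclideanSpace ℝ (Fin n)) :
    (w : Fin n → ℝ) ⬝ᵥ (hessian a y z *ᵥ (w : Fin n → ℝ)) =
      1 / (m : ℝ) * ∑ r, ((‖sample (a r) z‖ ^ 2 - y r) * ‖sample (a r) w‖ ^ 2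
        + 2 * (sample (a r) z * conj (sample (a r) w)).re ^ 2) := by
  have key : ∀ r, ((‖sample (a r) z‖ ^ 2 - y r) * ‖sample (a r) w‖ ^ 2
        + 2 * (sample (a r) z * conj (sample (a r) w)).re ^ 2) =
      ∑ j, ∑ k, w j * ((((2 * ‖sample (a r) z‖ ^ 2 - y r : ℝ) : ℂ) * (a r j * conj (a r k))
      + sample (a r) z ^ 2 * (a r j * a r k)).re * w k) := by
    intro r
    have h1 : (∑ j, ∑ k, w j * ((((2 * ‖sample (a r) z‖ ^ 2 - y r : ℝ) : ℂ)
        * (a r j * conj (a r k)) + sample (a r) z ^ 2 * (a r j * a r k)).re * w k)) =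
        ((((2 * ‖sample (a r) z‖ ^ 2 - y r : ℝ) : ℂ)) *
          (conj (sample (a r) w) * sample (a r) w)
          + sample (a r) z ^ 2 * (conj (sample (a r) w) * conj (sample (a r) w))).re := by
      have hc : conj (sample (a r) w) = ∑ j, a r j * (w j : ℂ) := by
        simp [sample]
      have hs : sample (a r) w = ∑ j, conj (a r j) * (w j : ℂ) := rfl
      rw [hc]
      rw [hs]
      rw [Finset.sum_mul_sum, Finset.sum_mul_sum, Finset.mul_sum, Finset.mul_sum,
        ← Finset.sum_add_distrib, Complex.re_sum]
      refine Finset.sum_congr rfl fun j _ => ?_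
      rw [Finset.mul_sum, Finset.mul_sum, ← Finset.sum_add_distrib, Complex.re_sum]
      refine Finset.sum_congr rfl fun k _ => ?_
      rw [← Complex.re_mul_ofReal, ← Complex.re_ofReal_mul]
      congr 1
      ring
    rw [h1, ← Complex.normSq_eq_norm_sq, ← Complex.normSq_eq_norm_sq]
    simp only [Complex.normSq_apply, Complex.add_re, Complex.mul_re, Complex.mul_im,
      Complex.ofReal_re, Complex.ofReal_im, Complex.conj_re, Complex.conj_im, pow_two]
    ring
  simp only [key, dotProduct, Matrix.mulVec, hessian, Matrix.of_apply, Finset.mul_sum,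
    Finset.sum_mul]
  symm
  rw [Finset.sum_comm]
  refine Finset.sum_congr rfl fun j _ => ?_
  rw [Finset.sum_comm]
  refine Finset.sum_congr rfl fun k _ => Finset.sum_congr rfl fun r _ => ?_
  ring

/-- The matrix `hessian` is half of the second derivative of the cost. -/
theorem iteratedDeriv_two_cost {m n : ℕ} (a : Fin m → Fin n → ℂ) (y : Fin m → ℝ)
    (z w : EuclideanSpace ℝ (Fin n)) :
    iteratedDeriv 2 (fun t : ℝ => cost a y (z + t • w)) 0 =
      2 * ((w : Fin n → ℝ) ⬝ᵥ (hessian a y z *ᵥ (w : Fin n → ℝ))) := by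
  set c0 : Fin m → ℝ := fun r => ‖sample (a r) z‖ ^ 2 - y r with hc0
  set c1 : Fin m → ℝ := fun r => 2 * (sample (a r) z * conj (sample (a r) w)).re with hc1
  set c2 : Fin m → ℝ := fun r => ‖sample (a r) w‖ ^ 2 with hc2
  have hf : (fun t : ℝ => cost a y (z + t • w)) = fun t =>
      1 / (2 * (m : ℝ)) * ∑ r, (c0 r + c1 r * t + c2 r * t ^ 2) ^ 2 := by
    funext t
    unfold cost
    congr 1
    refine Finset.sum_congr rfl fun r _ => ?_
    have hlin : sample (a r) (z + t • w) = sample (a r) z + t * sample (a r) w := by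
      simp only [sample, PiLp.add_apply, PiLp.smul_apply, smul_eq_mul, Complex.ofReal_add,
        Complex.ofReal_mul, Finset.mul_sum, ← Finset.sum_add_distrib]
      refine Finset.sum_congr rfl fun j _ => ?_
      ring
    congr 1
    simp only [hc0, hc1, hc2, hlin, ← Complex.normSq_eq_norm_sq]
    simp only [Complex.normSq_apply, Complex.add_re, Complex.add_im, Complex.mul_re,
      Complex.mul_im, Complex.ofReal_re, Complex.ofReal_im, Complex.conj_re, Complex.conj_im]
    ring
  have hb : ∀ r (t : ℝ), HasDerivAt (fun t : ℝ => c0 r + c1 r * t + c2 r * t ^ 2)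
      (c1 r + 2 * c2 r * t) t := by
    intro r t
    have := (((hasDerivAt_id t).const_mul (c1 r)).const_add (c0 r)).add
      ((hasDerivAt_pow 2 t).const_mul (c2 r))
    refine this.congr_deriv ?_
    simp
    ring
  have hb' : ∀ r (t : ℝ), HasDerivAt (fun t : ℝ => c1 r + 2 * c2 r * t) (2 * c2 r) t := by
    intro r t
    simpa using ((hasDerivAt_id t).const_mul (2 * c2 r)).const_add (c1 r)
  have hd1 : deriv (fun t : ℝ => 1 / (2 * (m : ℝ)) *
        ∑ r, (c0 r + c1 r * t + c2 r * t ^ 2) ^ 2) =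
      fun t => 1 / (2 * (m : ℝ)) *
        ∑ r, 2 * ((c0 r + c1 r * t + c2 r * t ^ 2) * (c1 r + 2 * c2 r * t)) := by
    funext t
    refine HasDerivAt.deriv (HasDerivAt.const_mul _ (HasDerivAt.fun_sum fun r _ => ?_))
    refine ((hb r t).pow 2).congr_deriv ?_
    simp
    ring
  have hd2 : deriv (fun t : ℝ => 1 / (2 * (m : ℝ)) *
        ∑ r, 2 * ((c0 r + c1 r * t + c2 r * t ^ 2) * (c1 r + 2 * c2 r * t))) 0 =
      1 / (2 * (m : ℝ)) * ∑ r, 2 * (c1 r * c1 r + c0 r * (2 * c2 r)) := by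
    refine HasDerivAt.deriv (HasDerivAt.const_mul _ (HasDerivAt.fun_sum fun r _ => ?_))
    refine (((hb r 0).mul (hb' r 0)).const_mul 2).congr_deriv ?_
    simp
  rw [hf, iteratedDeriv_succ, iteratedDeriv_one, hd1, hd2, quadForm_hessian,
    Finset.mul_sum, Finset.mul_sum, Finset.mul_sum]
  refine Finset.sum_congr rfl fun r _ => ?_
  simp only [hc0, hc1, hc2]
  rcases eq_or_ne (m : ℝ) 0 with hm | hm
  · simp [hm]
  · field_simp
    ring

end PhaseRetrieval

end

/-!
Why the theorem is true. Up to the factor `1 / m`, the quadratic form of the Hessian at `z` in the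
direction `w` is `∑ᵣ (q(aᵣ* z, aᵣ* w) - |aᵣ* x|² |aᵣ* w|²)` with the nonnegative quartic form
`q(u, v) = |u|² |v|² + 2 Re (u v̄)²`. For `‖x‖ = ‖w‖ = 1` its expectation per sample is
`2 ‖z‖² + 4 ⟨z, w⟩² - 1 - ⟨x, w⟩²`, which exceeds `4 / 5` when `‖z - x‖ ≤ 1 / 24`. The moments come
from the fact that a linear combination of the Gaussian entries with complex coefficients is again
Gaussian (`map_complexSample`), together with the polarization identities that express `q(u, v)`
and `|u|² |v|²` through fourth powers of moduli.

The sum is bounded below uniformly in `z` and `w` by truncating at the level `A = 100`. The form `q`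
is nonnegative and only decreases when its arguments are retracted to the disc of radius `A`
(`clip`), and `|aᵣ* x|²` splits into `min (|aᵣ* x|, A)²` and an `excess`.

* The truncated deficit `truncDeficit` is dominated by `1 + |aᵣ* w|²`, so a Bernstein estimate
  gives failure probability `exp (-c m)` for each pair `(z, w)`. It is Lipschitz in `(z, w)` up to
  the factor `1 + ∑ⱼ |aⱼ|²`, whose sample mean is `O(n)`. Hence a net of mesh of order `1 / n`, with
  `exp (O(n log n))` points, suffices; this is paid for by `m ≥ C n log n`
  (`exists_measureReal_truncDeficit_uniform_le`).
* The excess contributes a positive semidefinite form in `w` with small expectation, where a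
  constant factor may be lost. So a `1/2`-net of the sphere, with `5 ^ n` points, is enough. If all
  `|aᵣ* x|²` are below a cap `B`, each point fails with probability `exp (-m / (160 B))`, and the
  cap is violated with probability at most `2 m exp (-B / 2)` (`measureReal_excess_uniform_le`).

Choosing `B` proportional to `min (m / n, √m)` makes all these errors at most
`exp (-γ min (m / n, √m))`. The factor `m` is absorbed since `m ≥ C n log n` forces
`min (m / n, √m)` to dominate any multiple of `log m` when `n ≥ 2`; for `n = 1`, where this fails,
the Hessian is nonnegative deterministically. Convexity follows by restricting the cost to segments.
-/

noncomputable section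

namespace PhaseRetrieval

/-! ### Nets -/

/-- Points of a ball of radius `R` at mutual distance at least `ε` have disjoint balls of radius
`ε / 2`; comparing volumes bounds their number. -/
theorem card_le_of_separated_subset_closedBall {E : Type*} [NormedAddCommGroup E]
    [NormedSpace ℝ E] [FiniteDimensional ℝ E] {R ε : ℝ} (hR : 0 ≤ R) (hε : 0 < ε)
    (s : Finset E) (hs : ∀ c ∈ s, ‖c‖ ≤ R) (h : ∀ c ∈ s, ∀ d ∈ s, c ≠ d → ε ≤ ‖c - d‖) :
    (s.card : ℝ) ≤ (1 + 2 * R / ε) ^ Module.finrank ℝ E := by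
  borelize E
  let μ : Measure E := Measure.addHaar
  set d := Module.finrank ℝ E
  have hδ : 0 < ε / 2 := by positivity
  have hρ : 0 < R + ε / 2 := by positivity
  have hdisj : Set.Pairwise (s : Set E)
      (Function.onFun Disjoint fun c => Metric.ball c (ε / 2)) := by
    rintro c hc e he hce
    apply Metric.ball_disjoint_ball
    rw [dist_eq_norm, add_halves]
    exact h c hc e he hce
  have hsub : (⋃ c ∈ s, Metric.ball c (ε / 2)) ⊆ Metric.ball (0 : E) (R + ε / 2) := by
    refine Set.iUnion₂_subset fun x hx => Metric.ball_subset_ball' ?_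
    rw [dist_zero_right]
    linarith [hs x hx]
  have hvol : (s.card : ENNReal) * ENNReal.ofReal ((ε / 2) ^ d) * μ (Metric.ball 0 1) ≤
      ENNReal.ofReal ((R + ε / 2) ^ d) * μ (Metric.ball 0 1) := by
    calc (s.card : ENNReal) * ENNReal.ofReal ((ε / 2) ^ d) * μ (Metric.ball 0 1)
        = μ (⋃ c ∈ s, Metric.ball c (ε / 2)) := by
          rw [measure_biUnion_finset hdisj fun c _ => measurableSet_ball]
          simp only [μ.addHaar_ball_of_pos _ hδ, Finset.sum_const, nsmul_eq_mul, mul_assoc, d]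
      _ ≤ μ (Metric.ball (0 : E) (R + ε / 2)) := measure_mono hsub
      _ = _ := by simp only [μ.addHaar_ball_of_pos _ hρ, d]
  have hcard : (s.card : ENNReal) * ENNReal.ofReal ((ε / 2) ^ d) ≤
      ENNReal.ofReal ((R + ε / 2) ^ d) :=
    (ENNReal.mul_le_mul_iff_left (Metric.measure_ball_pos _ _ zero_lt_one).ne'
      measure_ball_lt_top.ne).1 hvol
  have hreal := ENNReal.toReal_le_of_le_ofReal (by positivity) hcard
  rw [ENNReal.toReal_mul, ENNReal.toReal_natCast, ENNReal.toReal_ofReal (by positivity)] at hreal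
  have heq : (1 + 2 * R / ε) ^ d = (R + ε / 2) ^ d / (ε / 2) ^ d := by
    rw [← div_pow]; congr 1; field_simp; ring
  rw [heq, le_div_iff₀ (by positivity)]
  exact hreal

/-- Every subset of a ball in a finite-dimensional space has an `ε`-net consisting of its own
points, of cardinality exponential in the dimension: take a maximal separated subset. -/
theorem exists_finset_net {E : Type*} [NormedAddCommGroup E]
    [NormedSpace ℝ E] [FiniteDimensional ℝ E] {R ε : ℝ} (hR : 0 ≤ R) (hε : 0 < ε)
    (S : Set E) (hS : ∀ c ∈ S, ‖c‖ ≤ R) :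
    ∃ s : Finset E, (∀ c ∈ s, c ∈ S) ∧ (∀ v ∈ S, ∃ c ∈ s, ‖v - c‖ ≤ ε) ∧
      (s.card : ℝ) ≤ (1 + 2 * R / ε) ^ Module.finrank ℝ E := by
  classical
  let p : ℕ → Prop := fun k => ∃ s : Finset E, s.card = k ∧ (∀ c ∈ s, c ∈ S) ∧
    ∀ c ∈ s, ∀ d ∈ s, c ≠ d → ε ≤ ‖c - d‖
  have hbound : ∀ s : Finset E, (∀ c ∈ s, c ∈ S) → (∀ c ∈ s, ∀ d ∈ s, c ≠ d → ε ≤ ‖c - d‖) →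
      (s.card : ℝ) ≤ (1 + 2 * R / ε) ^ Module.finrank ℝ E := fun s h1 h2 =>
    card_le_of_separated_subset_closedBall hR hε s (fun c hc => hS c (h1 c hc)) h2
  set N := ⌊(1 + 2 * R / ε) ^ Module.finrank ℝ E⌋₊
  have hp0 : p 0 := ⟨∅, by simp⟩
  obtain ⟨s, hcard, hsS, hsep⟩ := Nat.findGreatest_spec (P := p) (Nat.zero_le N) hp0
  refine ⟨s, hsS, fun v hv => ?_, hbound s hsS hsep⟩
  by_contra! hfar
  have hvs : v ∉ s := fun hvs => by
    have := hfar v hvs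
    simp at this
    linarith
  have hins1 : ∀ c ∈ insert v s, c ∈ S := by
    intro c hc
    rcases Finset.mem_insert.1 hc with rfl | hc
    exacts [hv, hsS c hc]
  have hins2 : ∀ c ∈ insert v s, ∀ d ∈ insert v s, c ≠ d → ε ≤ ‖c - d‖ := by
    intro c hc d hd hcd
    rcases Finset.mem_insert.1 hc with hc' | hc' <;> rcases Finset.mem_insert.1 hd with hd' | hd'
    · exact absurd (hc'.trans hd'.symm) hcd
    · rw [hc']; exact (hfar d hd').le
    · rw [hd', norm_sub_rev]; exact (hfar c hc').le
    · exact hsep c hc' d hd' hcd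
  have hle : (insert v s).card ≤ N := Nat.le_floor (hbound _ hins1 hins2)
  have := Nat.le_findGreatest (P := p) hle ⟨insert v s, rfl, hins1, hins2⟩
  rw [Finset.card_insert_of_notMem hvs] at this
  omega

/-- A linear map that is at most `M` on a `1/2`-net of the unit sphere has norm at most `2 M`. -/
theorem norm_le_two_mul_of_net {E F : Type*} [NormedAddCommGroup E] [NormedSpace ℝ E]
    [NormedAddCommGroup F] [NormedSpace ℝ F] (L : E →L[ℝ] F) {M : ℝ} (hM : 0 ≤ M) (N : Set E)
    (hN : ∀ v : E, ‖v‖ = 1 → ∃ c ∈ N, ‖v - c‖ ≤ 1 / 2) (hL : ∀ c ∈ N, ‖L c‖ ≤ M) :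
    ‖L‖ ≤ 2 * M := by
  have : ‖L‖ ≤ M + ‖L‖ * (1 / 2) := by
    refine ContinuousLinearMap.opNorm_le_of_unit_norm (by positivity) fun v hv => ?_
    obtain ⟨c, hc, hvc⟩ := hN v hv
    calc ‖L v‖ = ‖L c + L (v - c)‖ := by rw [← map_add]; congr 2; abel
      _ ≤ ‖L c‖ + ‖L (v - c)‖ := norm_add_le _ _
      _ ≤ M + ‖L‖ * (1 / 2) := by
        refine add_le_add (hL c hc) ((L.le_opNorm _).trans ?_)
        gcongr
  linarith

/-! ### The law of a linear measurement -/

instance : IsProbabilityMeasure complexGaussian :=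
  Measure.isProbabilityMeasure_map (by fun_prop)

instance (n : ℕ) : IsProbabilityMeasure (complexGaussianVector n) := by
  unfold complexGaussianVector; infer_instance

theorem lintegral_complexGaussian (f : ℂ → ENNReal) (hf : Measurable f) :
    ∫⁻ c, f c ∂complexGaussian =
      ∫⁻ c, ENNReal.ofReal (Real.pi⁻¹ * Real.exp (-‖c‖ ^ 2)) * f c := by
  have hv : (1 / 2 : NNReal) ≠ 0 := by norm_num
  unfold complexGaussian
  rw [lintegral_map hf (by fun_prop), gaussianReal_of_var_ne_zero _ hv,
    prod_withDensity (by fun_prop) (by fun_prop),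
    lintegral_withDensity_eq_lintegral_mul _ (by fun_prop) (by fun_prop),
    ← (Complex.volume_preserving_equiv_real_prod.symm).lintegral_comp_emb
      Complex.measurableEquivRealProd.symm.measurableEmbedding]
  rw [← Measure.volume_eq_prod]
  refine lintegral_congr fun p => ?_
  simp only [Pi.mul_apply]
  congr 1
  rw [gaussianPDF, gaussianPDF, ← ENNReal.ofReal_mul (gaussianPDFReal_nonneg _ _ _)]
  congr 1
  rw [gaussianPDFReal, gaussianPDFReal, ← Complex.normSq_eq_norm_sq, Complex.normSq_apply]
  simp only [Complex.measurableEquivRealProd_symm_apply]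
  rw [mul_mul_mul_comm, ← Real.exp_add]
  congr 1
  · rw [← mul_inv, Real.mul_self_sqrt (by positivity)]
    norm_num
    ring
  · congr 1
    norm_num
    ring

theorem integral_complexGaussian (f : ℂ → ℝ) (hf : Measurable f) (h0 : ∀ c, 0 ≤ f c) :
    ∫ c, f c ∂complexGaussian = ∫ c, (Real.pi⁻¹ * Real.exp (-‖c‖ ^ 2)) * f c := by
  rw [integral_eq_lintegral_of_nonneg_ae (ae_of_all _ h0) (by fun_prop),
    integral_eq_lintegral_of_nonneg_ae (ae_of_all _ fun c => by have := h0 c; positivity)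
      (by fun_prop), lintegral_complexGaussian _ (by fun_prop)]
  congr 1
  refine lintegral_congr fun c => ?_
  rw [← ENNReal.ofReal_mul (by positivity)]

theorem integral_exp_half_complexGaussian :
    ∫ c, Real.exp (‖c‖ ^ 2 / 2) ∂complexGaussian = 2 := by
  rw [integral_complexGaussian _ (by fun_prop) (fun c => (Real.exp_pos _).le)]
  have h := Complex.integral_exp_neg_mul_rpow (p := 2) (b := 1 / 2) (by norm_num) (by norm_num)
  have h2 : ∀ c : ℂ, Real.pi⁻¹ * Real.exp (-‖c‖ ^ 2) * Real.exp (‖c‖ ^ 2 / 2) =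
      Real.pi⁻¹ * Real.exp (-(1 / 2) * ‖c‖ ^ (2 : ℝ)) := by
    intro c
    rw [mul_assoc, ← Real.exp_add]
    congr 2
    norm_cast
    ring
  simp_rw [h2]
  rw [integral_const_mul, h]
  norm_num

theorem integral_norm_pow_four_complexGaussian : ∫ c, ‖c‖ ^ 4 ∂complexGaussian = 2 := by
  rw [integral_complexGaussian _ (by fun_prop) (fun c => by positivity)]
  have h := Complex.integral_rpow_mul_exp_neg_rpow (p := 2) (q := 4) (by norm_num) (by norm_num)
  have h2 : ∀ c : ℂ, Real.pi⁻¹ * Real.exp (-‖c‖ ^ 2) * ‖c‖ ^ 4 =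
      Real.pi⁻¹ * (‖c‖ ^ (4 : ℝ) * Real.exp (-‖c‖ ^ (2 : ℝ))) := by
    intro c
    norm_cast
    ring
  simp_rw [h2]
  rw [integral_const_mul, h]
  have : Real.Gamma ((4 + 2) / 2) = 2 := by
    have := Real.Gamma_nat_eq_factorial 2
    norm_num at this ⊢
  rw [this]
  field_simp

theorem integrable_exp_half_complexGaussian :
    Integrable (fun c => Real.exp (‖c‖ ^ 2 / 2)) complexGaussian := by
  by_contra h
  have := integral_exp_half_complexGaussian
  rw [integral_undef h] at this
  norm_num at this

theorem charFun_complexGaussian (t : ℂ) :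
    charFun complexGaussian t = Complex.exp (-(‖t‖ ^ 2 / 4 : ℝ)) := by
  rw [charFun_apply, complexGaussian, integral_map (by fun_prop) (by fun_prop)]
  have h : ∀ p : ℝ × ℝ, Complex.exp (inner ℝ (Complex.measurableEquivRealProd.symm p) t * Complex.I)
      = Complex.exp (inner ℝ p.1 t.re * Complex.I) *
        Complex.exp (inner ℝ p.2 t.im * Complex.I) := by
    intro p
    rw [← Complex.exp_add, ← add_mul]
    congr 2
    rw [Complex.inner]
    simp
  simp_rw [h]
  rw [integral_prod_mul (fun x : ℝ => Complex.exp (inner ℝ x t.re * Complex.I))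
    (fun x : ℝ => Complex.exp (inner ℝ x t.im * Complex.I)), ← charFun_apply, ← charFun_apply,
    charFun_gaussianReal,
    charFun_gaussianReal, ← Complex.exp_add, ← Complex.normSq_eq_norm_sq, Complex.normSq_apply]
  congr 1
  push_cast
  ring

/-- The linear measurement `a* ζ` of a complex signal `ζ`. -/
def complexSample {n : ℕ} (a : Fin n → ℂ) (ζ : Fin n → ℂ) : ℂ := ∑ j, conj (a j) * ζ j

@[fun_prop]
theorem measurable_complexSample {n : ℕ} (ζ : Fin n → ℂ) :
    Measurable fun a : Fin n → ℂ => complexSample a ζ := by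
  unfold complexSample; fun_prop

/-- A linear combination of independent standard complex Gaussians with coefficients of square sum
`ρ²` is again Gaussian: it has the law of `ρ` times a standard complex Gaussian. -/
theorem map_complexSample {n : ℕ} (ζ : Fin n → ℂ) (ρ : ℝ) (hρ : ρ ^ 2 = ∑ j, ‖ζ j‖ ^ 2) :
    (complexGaussianVector n).map (fun a => complexSample a ζ) =
      complexGaussian.map (fun c => ρ • c) := by
  have : IsProbabilityMeasure ((complexGaussianVector n).map (fun a => complexSample a ζ)) :=
    Measure.isProbabilityMeasure_map (by fun_prop)
  have : IsProbabilityMeasure (complexGaussian.map (fun c : ℂ => ρ • c)) :=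
    Measure.isProbabilityMeasure_map (by fun_prop)
  refine Measure.ext_of_charFun (funext fun t => ?_)
  rw [charFun_map_smul, charFun_complexGaussian, charFun_apply,
    integral_map (by fun_prop) (by fun_prop), complexGaussianVector]
  have h : ∀ a : Fin n → ℂ, Complex.exp (inner ℝ (complexSample a ζ) t * Complex.I) =
      ∏ j, Complex.exp (inner ℝ (a j) (ζ j * conj t) * Complex.I) := by
    intro a
    rw [← Complex.exp_sum, ← Finset.sum_mul, complexSample, sum_inner]
    push_cast
    congr 2
    refine Finset.sum_congr rfl fun j _ => ?_
    simp only [Complex.inner, Complex.mul_re, Complex.mul_im, Complex.conj_re, Complex.conj_im,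
      map_mul, Complex.conj_conj]
    congr 1
    ring
  simp_rw [h]
  rw [integral_fintype_prod_eq_prod (f := fun j (c : ℂ) =>
    Complex.exp (inner ℝ c (ζ j * conj t) * Complex.I))]
  simp_rw [← charFun_apply, charFun_complexGaussian]
  rw [← Complex.exp_sum]
  congr 1
  norm_cast
  simp only [norm_mul, RCLike.norm_conj, mul_pow, norm_smul, Real.norm_eq_abs, sq_abs, hρ,
    Finset.sum_mul, Finset.sum_div, Finset.sum_neg_distrib]

variable {n : ℕ}

theorem integral_complexSample (g : ℂ → ℝ) (hg : Measurable g) (ζ : Fin n → ℂ) (ρ : ℝ)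
    (hρ : ρ ^ 2 = ∑ j, ‖ζ j‖ ^ 2) :
    ∫ a, g (complexSample a ζ) ∂complexGaussianVector n = ∫ c, g (ρ • c) ∂complexGaussian := by
  rw [← integral_map (φ := fun a => complexSample a ζ) (f := g) (by fun_prop) (by fun_prop),
    map_complexSample ζ ρ hρ, integral_map (by fun_prop) (by fun_prop)]

theorem integrable_complexSample_iff (g : ℂ → ℝ) (hg : Measurable g) (ζ : Fin n → ℂ) (ρ : ℝ)
    (hρ : ρ ^ 2 = ∑ j, ‖ζ j‖ ^ 2) :
    Integrable (fun a => g (complexSample a ζ)) (complexGaussianVector n) ↔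
      Integrable (fun c => g (ρ • c)) complexGaussian := by
  rw [← Function.comp_def g, ← integrable_map_measure (g := g) (by fun_prop) (by fun_prop),
    map_complexSample ζ ρ hρ, integrable_map_measure (by fun_prop) (by fun_prop)]
  rfl

theorem pow_le_factorial_mul_exp_half {t : ℝ} (ht : 0 ≤ t) (k : ℕ) :
    t ^ k ≤ 2 ^ k * k.factorial * Real.exp (t / 2) := by
  have := Real.pow_div_factorial_le_exp (t / 2) (by positivity) k
  rw [div_le_iff₀ (by positivity), div_pow, div_le_iff₀ (by positivity)] at this
  linarith

theorem integrable_norm_pow_complexGaussian (k : ℕ) :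
    Integrable (fun c => ‖c‖ ^ (2 * k)) complexGaussian := by
  refine (integrable_exp_half_complexGaussian.const_mul (2 ^ k * k.factorial)).mono'
    (by fun_prop) (ae_of_all _ fun c => ?_)
  rw [Real.norm_of_nonneg (by positivity), pow_mul]
  exact pow_le_factorial_mul_exp_half (by positivity) k

theorem integral_norm_pow_complexGaussian_le (k : ℕ) :
    ∫ c, ‖c‖ ^ (2 * k) ∂complexGaussian ≤ 2 ^ (k + 1) * k.factorial := by
  calc ∫ c, ‖c‖ ^ (2 * k) ∂complexGaussian
      ≤ ∫ c, 2 ^ k * k.factorial * Real.exp (‖c‖ ^ 2 / 2) ∂complexGaussian := by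
        refine integral_mono (integrable_norm_pow_complexGaussian k)
          (integrable_exp_half_complexGaussian.const_mul _) fun c => ?_
        simp only [pow_mul]
        exact pow_le_factorial_mul_exp_half (by positivity) k
    _ = 2 ^ (k + 1) * k.factorial := by
        rw [integral_const_mul, integral_exp_half_complexGaussian]; ring

theorem integrable_norm_complexSample_pow (ζ : Fin n → ℂ) (k : ℕ) :
    Integrable (fun a => ‖complexSample a ζ‖ ^ (2 * k)) (complexGaussianVector n) := by
  rw [integrable_complexSample_iff (fun c => ‖c‖ ^ (2 * k)) (by fun_prop) ζ
    (√(∑ j, ‖ζ j‖ ^ 2)) (Real.sq_sqrt (by positivity))]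
  simp only [norm_smul, mul_pow]
  exact (integrable_norm_pow_complexGaussian k).const_mul _

theorem integral_norm_complexSample_pow_four (ζ : Fin n → ℂ) :
    ∫ a, ‖complexSample a ζ‖ ^ 4 ∂complexGaussianVector n = 2 * (∑ j, ‖ζ j‖ ^ 2) ^ 2 := by
  have hρ : √(∑ j, ‖ζ j‖ ^ 2) ^ 2 = ∑ j, ‖ζ j‖ ^ 2 := Real.sq_sqrt (by positivity)
  rw [integral_complexSample (fun c => ‖c‖ ^ 4) (by fun_prop) ζ _ hρ]
  simp only [norm_smul, mul_pow]
  rw [integral_const_mul, integral_norm_pow_four_complexGaussian, Real.norm_eq_abs,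
    abs_of_nonneg (Real.sqrt_nonneg _), show 4 = 2 * 2 from rfl, pow_mul, hρ]
  ring

theorem sample_eq_complexSample (a : Fin n → ℂ) (z : EuclideanSpace ℝ (Fin n)) :
    sample a z = complexSample a fun j => (z j : ℂ) := rfl

@[fun_prop]
theorem measurable_sample (z : EuclideanSpace ℝ (Fin n)) :
    Measurable fun a : Fin n → ℂ => sample a z :=
  measurable_complexSample _

theorem norm_sq_eq_sum_norm_coe (z : EuclideanSpace ℝ (Fin n)) :
    ‖z‖ ^ 2 = ∑ j, ‖(z j : ℂ)‖ ^ 2 := by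
  simp [EuclideanSpace.norm_sq_eq]

theorem integral_exp_half_sample {w : EuclideanSpace ℝ (Fin n)} (hw : ‖w‖ = 1) :
    ∫ a, Real.exp (‖sample a w‖ ^ 2 / 2) ∂complexGaussianVector n = 2 := by
  have := integral_complexSample (fun c => Real.exp (‖c‖ ^ 2 / 2)) (by fun_prop) _ _
    (norm_sq_eq_sum_norm_coe w)
  simpa only [hw, one_smul, integral_exp_half_complexGaussian, ← sample_eq_complexSample] using this

theorem integrable_exp_half_sample {w : EuclideanSpace ℝ (Fin n)} (hw : ‖w‖ = 1) :
    Integrable (fun a => Real.exp (‖sample a w‖ ^ 2 / 2)) (complexGaussianVector n) := by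
  refine (integrable_complexSample_iff (fun c => Real.exp (‖c‖ ^ 2 / 2)) (by fun_prop) _ _
    (norm_sq_eq_sum_norm_coe w)).2 ?_
  simpa only [hw, one_smul] using integrable_exp_half_complexGaussian

theorem integral_norm_sample_pow_le (z : EuclideanSpace ℝ (Fin n)) (k : ℕ) :
    ∫ a, ‖sample a z‖ ^ (2 * k) ∂complexGaussianVector n ≤
      2 ^ (k + 1) * k.factorial * ‖z‖ ^ (2 * k) := by
  have := integral_complexSample (fun c => ‖c‖ ^ (2 * k)) (by fun_prop) _ _
    (norm_sq_eq_sum_norm_coe z)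
  rw [show (∫ a, ‖sample a z‖ ^ (2 * k) ∂complexGaussianVector n) = _ from this]
  simp only [norm_smul, mul_pow, norm_norm]
  rw [integral_const_mul, mul_comm]
  gcongr
  exact integral_norm_pow_complexGaussian_le k

/-! ### Polarization and joint fourth moments -/

/-- The quartic form `|u|² |v|² + 2 Re (u v̄)²`, which is the polarization of `|u|⁴`. -/
def quarticForm (u v : ℂ) : ℝ := ‖u‖ ^ 2 * ‖v‖ ^ 2 + 2 * (u * conj v).re ^ 2

theorem quarticForm_eq_polarization (u v : ℂ) :
    quarticForm u v = (‖u + v‖ ^ 4 + ‖u - v‖ ^ 4 - 2 * ‖u‖ ^ 4 - 2 * ‖v‖ ^ 4) / 4 := by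
  have h : ∀ c : ℂ, ‖c‖ ^ 4 = (c.re * c.re + c.im * c.im) ^ 2 := fun c => by
    rw [show 4 = 2 * 2 from rfl, pow_mul, ← Complex.normSq_eq_norm_sq, Complex.normSq_apply]
  rw [quarticForm, ← Complex.normSq_eq_norm_sq, ← Complex.normSq_eq_norm_sq]
  simp only [h, Complex.normSq_apply, Complex.add_re, Complex.add_im, Complex.sub_re,
    Complex.sub_im, Complex.mul_re, Complex.conj_re, Complex.conj_im]
  ring

/-- The imaginary directions `u ± i v` remove the term `Re (u v̄)²` from the polarization. -/
theorem norm_sq_mul_norm_sq_eq_polarization (u v : ℂ) :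
    ‖u‖ ^ 2 * ‖v‖ ^ 2 = (‖u + v‖ ^ 4 + ‖u - v‖ ^ 4 + ‖u + Complex.I * v‖ ^ 4
      + ‖u - Complex.I * v‖ ^ 4 - 4 * ‖u‖ ^ 4 - 4 * ‖v‖ ^ 4) / 16 := by
  have h : ∀ c : ℂ, ‖c‖ ^ 4 = (c.re * c.re + c.im * c.im) ^ 2 := fun c => by
    rw [show 4 = 2 * 2 from rfl, pow_mul, ← Complex.normSq_eq_norm_sq, Complex.normSq_apply]
  rw [← Complex.normSq_eq_norm_sq, ← Complex.normSq_eq_norm_sq]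
  simp only [h, Complex.normSq_apply, Complex.add_re, Complex.add_im, Complex.sub_re,
    Complex.sub_im, Complex.mul_re, Complex.mul_im, Complex.I_re, Complex.I_im]
  ring

theorem complexSample_add (a ζ η : Fin n → ℂ) :
    complexSample a (fun j => ζ j + η j) = complexSample a ζ + complexSample a η := by
  simp [complexSample, mul_add, Finset.sum_add_distrib]

theorem complexSample_sub (a ζ η : Fin n → ℂ) :
    complexSample a (fun j => ζ j - η j) = complexSample a ζ - complexSample a η := by
  simp [complexSample, mul_sub, Finset.sum_sub_distrib]

theorem complexSample_mul (a η : Fin n → ℂ) (c : ℂ) :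
    complexSample a (fun j => c * η j) = c * complexSample a η := by
  simp only [complexSample, Finset.mul_sum]
  exact Finset.sum_congr rfl fun j _ => by ring

section Moments

variable (z w : EuclideanSpace ℝ (Fin n))

theorem sum_norm_coe_add : ∑ j, ‖(z j : ℂ) + w j‖ ^ 2 = ‖z‖ ^ 2 + 2 * inner ℝ z w + ‖w‖ ^ 2 := by
  rw [← norm_add_sq_real, norm_sq_eq_sum_norm_coe]; simp

theorem sum_norm_coe_sub : ∑ j, ‖(z j : ℂ) - w j‖ ^ 2 = ‖z‖ ^ 2 - 2 * inner ℝ z w + ‖w‖ ^ 2 := by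
  rw [← norm_sub_sq_real, norm_sq_eq_sum_norm_coe]; simp

theorem sum_norm_coe_add_I_mul : ∑ j, ‖(z j : ℂ) + Complex.I * w j‖ ^ 2 = ‖z‖ ^ 2 + ‖w‖ ^ 2 := by
  simp_rw [norm_sq_eq_sum_norm_coe, ← Finset.sum_add_distrib, ← Complex.normSq_eq_norm_sq,
    Complex.normSq_apply]
  simp

theorem sum_norm_coe_sub_I_mul : ∑ j, ‖(z j : ℂ) - Complex.I * w j‖ ^ 2 = ‖z‖ ^ 2 + ‖w‖ ^ 2 := by
  simp_rw [norm_sq_eq_sum_norm_coe, ← Finset.sum_add_distrib, ← Complex.normSq_eq_norm_sq,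
    Complex.normSq_apply]
  simp

theorem integrable_norm_complexSample_pow_four (ζ : Fin n → ℂ) :
    Integrable (fun a => ‖complexSample a ζ‖ ^ 4) (complexGaussianVector n) :=
  integrable_norm_complexSample_pow ζ 2

theorem integrable_quarticForm_sample :
    Integrable (fun a => quarticForm (sample a z) (sample a w)) (complexGaussianVector n) := by
  simp_rw [quarticForm_eq_polarization, sample_eq_complexSample, ← complexSample_add,
    ← complexSample_sub]
  have h := integrable_norm_complexSample_pow_four (n := n)
  exact ((((h _).add (h _)).sub ((h _).const_mul 2)).sub ((h _).const_mul 2)).div_const 4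

theorem integral_quarticForm_sample :
    ∫ a, quarticForm (sample a z) (sample a w) ∂complexGaussianVector n =
      2 * ‖z‖ ^ 2 * ‖w‖ ^ 2 + 4 * inner ℝ z w ^ 2 := by
  simp_rw [quarticForm_eq_polarization, sample_eq_complexSample, ← complexSample_add,
    ← complexSample_sub]
  have h := integrable_norm_complexSample_pow_four (n := n)
  rw [integral_div, integral_sub, integral_sub, integral_add, integral_const_mul,
    integral_const_mul]
  · simp_rw [integral_norm_complexSample_pow_four, ← norm_sq_eq_sum_norm_coe, sum_norm_coe_add,
      sum_norm_coe_sub]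
    ring
  · exact h _
  · exact h _
  · exact (h _).add (h _)
  · exact (h _).const_mul 2
  · exact ((h _).add (h _)).sub ((h _).const_mul 2)
  · exact (h _).const_mul 2

theorem integrable_norm_sq_mul_norm_sq_sample :
    Integrable (fun a => ‖sample a z‖ ^ 2 * ‖sample a w‖ ^ 2) (complexGaussianVector n) := by
  simp_rw [norm_sq_mul_norm_sq_eq_polarization, sample_eq_complexSample, ← complexSample_mul,
    ← complexSample_add, ← complexSample_sub]
  have h := integrable_norm_complexSample_pow_four (n := n)
  exact ((((((h _).add (h _)).add (h _)).add (h _)).sub ((h _).const_mul 4)).sub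
    ((h _).const_mul 4)).div_const 16

theorem integral_norm_sq_mul_norm_sq_sample :
    ∫ a, ‖sample a z‖ ^ 2 * ‖sample a w‖ ^ 2 ∂complexGaussianVector n =
      ‖z‖ ^ 2 * ‖w‖ ^ 2 + inner ℝ z w ^ 2 := by
  simp_rw [norm_sq_mul_norm_sq_eq_polarization, sample_eq_complexSample, ← complexSample_mul,
    ← complexSample_add, ← complexSample_sub]
  have h := integrable_norm_complexSample_pow_four (n := n)
  rw [integral_div, integral_sub, integral_sub, integral_add, integral_add, integral_add,
    integral_const_mul, integral_const_mul]
  · simp_rw [integral_norm_complexSample_pow_four, ← norm_sq_eq_sum_norm_coe, sum_norm_coe_add,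
      sum_norm_coe_sub, sum_norm_coe_add_I_mul, sum_norm_coe_sub_I_mul]
    ring
  · exact h _
  · exact h _
  · exact (h _).add (h _)
  · exact h _
  · exact ((h _).add (h _)).add (h _)
  · exact h _
  · exact (((h _).add (h _)).add (h _)).add (h _)
  · exact (h _).const_mul 4
  · exact ((((h _).add (h _)).add (h _)).add (h _)).sub ((h _).const_mul 4)
  · exact (h _).const_mul 4

end Moments

/-! ### Truncation -/

/-- The radial retraction of `ℂ` onto the disc of radius `A`. -/
def clip (A : ℝ) (u : ℂ) : ℂ := min 1 (A / ‖u‖) • u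

theorem norm_clip {A : ℝ} (hA : 0 ≤ A) (u : ℂ) : ‖clip A u‖ = min ‖u‖ A := by
  rcases eq_or_ne u 0 with rfl | hu
  · simp [clip, hA]
  have hu' : 0 < ‖u‖ := norm_pos_iff.2 hu
  rw [clip, norm_smul, Real.norm_of_nonneg (by positivity), min_mul_of_nonneg _ _ hu'.le,
    one_mul, div_mul_cancel₀ _ hu'.ne']

theorem norm_clip_sub_clip_le {A : ℝ} (hA : 0 ≤ A) (u v : ℂ) :
    ‖clip A u - clip A v‖ ≤ 2 * ‖u - v‖ := by
  wlog huv : ‖u‖ ≤ ‖v‖ generalizing u v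
  · rw [norm_sub_rev, norm_sub_rev u]
    exact this v u (not_le.1 huv).le
  have hd : ‖v‖ - ‖u‖ ≤ ‖u - v‖ := by rw [norm_sub_rev]; exact norm_sub_norm_le v u
  have hs : 0 ≤ min 1 (A / ‖u‖) := by positivity
  have hs1 : min 1 (A / ‖u‖) ≤ 1 := min_le_left _ _
  have key : |min 1 (A / ‖u‖) - min 1 (A / ‖v‖)| * ‖v‖ ≤ ‖v‖ - ‖u‖ ∨ u = 0 := by
    rcases eq_or_ne u 0 with hu | hu
    · exact Or.inr hu
    refine Or.inl ?_
    have hu' : 0 < ‖u‖ := norm_pos_iff.2 hu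
    have hv' : 0 < ‖v‖ := hu'.trans_le huv
    have hle : A / ‖v‖ ≤ A / ‖u‖ := by gcongr
    rw [abs_of_nonneg (sub_nonneg.2 (min_le_min_left _ hle)), sub_mul,
      min_mul_of_nonneg _ _ hv'.le, min_mul_of_nonneg _ _ hv'.le, one_mul,
      div_mul_cancel₀ _ hv'.ne']
    rcases le_total ‖v‖ A with h | h
    · rw [min_eq_left h]
      linarith [min_le_left ‖v‖ (A / ‖u‖ * ‖v‖)]
    · rw [min_eq_right h]
      rcases le_total ‖u‖ A with h' | h'
      · linarith [min_le_left ‖v‖ (A / ‖u‖ * ‖v‖)]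
      · have h1 : A / ‖u‖ * ‖v‖ - A = A / ‖u‖ * (‖v‖ - ‖u‖) := by field_simp
        have h2 : A / ‖u‖ ≤ 1 := (div_le_one hu').2 h'
        have h3 := mul_le_mul_of_nonneg_right h2 (sub_nonneg.2 huv)
        linarith [min_le_right ‖v‖ (A / ‖u‖ * ‖v‖)]
  rcases key with key | rfl
  · calc ‖clip A u - clip A v‖
        = ‖min 1 (A / ‖u‖) • (u - v) + (min 1 (A / ‖u‖) - min 1 (A / ‖v‖)) • v‖ := by
          rw [clip, clip, smul_sub, sub_smul]; congr 1; abel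
      _ ≤ min 1 (A / ‖u‖) * ‖u - v‖ + |min 1 (A / ‖u‖) - min 1 (A / ‖v‖)| * ‖v‖ := by
          refine (norm_add_le _ _).trans ?_
          rw [norm_smul, norm_smul, Real.norm_of_nonneg hs, Real.norm_eq_abs]
      _ ≤ 1 * ‖u - v‖ + ‖u - v‖ := by gcongr; exact key.trans hd
      _ = _ := by ring
  · have : clip A 0 = 0 := by simp [clip]
    rw [this, zero_sub, norm_neg, norm_clip hA, zero_sub, norm_neg]
    linarith [min_le_left ‖v‖ A, norm_nonneg v]

theorem abs_re_mul_conj_le (u v : ℂ) : |(u * conj v).re| ≤ ‖u‖ * ‖v‖ := by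
  refine (Complex.abs_re_le_norm _).trans ?_
  rw [norm_mul, RCLike.norm_conj]

theorem quarticForm_nonneg (u v : ℂ) : 0 ≤ quarticForm u v := by
  unfold quarticForm; positivity

theorem quarticForm_le (u v : ℂ) : quarticForm u v ≤ 3 * (‖u‖ ^ 2 * ‖v‖ ^ 2) := by
  have := sq_le_sq' (neg_le_of_abs_le (abs_re_mul_conj_le u v))
    (le_of_abs_le (abs_re_mul_conj_le u v))
  unfold quarticForm
  linarith [mul_pow ‖u‖ ‖v‖ 2]

theorem quarticForm_smul (s t : ℝ) (u v : ℂ) :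
    quarticForm (s • u) (t • v) = s ^ 2 * t ^ 2 * quarticForm u v := by
  have : (s • u * conj (t • v)).re = s * t * (u * conj v).re := by
    simp [Complex.mul_re]; ring
  rw [quarticForm, this, norm_smul, norm_smul, mul_pow, mul_pow, Real.norm_eq_abs, sq_abs,
    Real.norm_eq_abs, sq_abs, quarticForm]
  ring

theorem abs_quarticForm_sub_le {A : ℝ} {u v u' v' : ℂ} (hu : ‖u‖ ≤ A) (hv : ‖v‖ ≤ A)
    (hu' : ‖u'‖ ≤ A) (hv' : ‖v'‖ ≤ A) :
    |quarticForm u v - quarticForm u' v'| ≤ 6 * A ^ 3 * (‖u - u'‖ + ‖v - v'‖) := by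
  have hA : 0 ≤ A := (norm_nonneg u).trans hu
  have h1 : |‖u‖ * ‖v‖ - ‖u'‖ * ‖v'‖| ≤ A * (‖u - u'‖ + ‖v - v'‖) := by
    calc |‖u‖ * ‖v‖ - ‖u'‖ * ‖v'‖| = |(‖u‖ - ‖u'‖) * ‖v‖ + ‖u'‖ * (‖v‖ - ‖v'‖)| := by ring_nf
      _ ≤ |‖u‖ - ‖u'‖| * ‖v‖ + ‖u'‖ * |‖v‖ - ‖v'‖| := by
        refine (abs_add_le _ _).trans ?_
        rw [abs_mul, abs_mul, abs_norm, abs_norm]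
      _ ≤ ‖u - u'‖ * A + A * ‖v - v'‖ := by
        gcongr
        exacts [abs_norm_sub_norm_le _ _, abs_norm_sub_norm_le _ _]
      _ = _ := by ring
  have h2 : |(u * conj v).re - (u' * conj v').re| ≤ A * (‖u - u'‖ + ‖v - v'‖) := by
    calc |(u * conj v).re - (u' * conj v').re|
        = |((u - u') * conj v).re + (u' * conj (v - v')).re| := by
          rw [← Complex.sub_re, ← Complex.add_re, map_sub]; ring_nf
      _ ≤ ‖u - u'‖ * ‖v‖ + ‖u'‖ * ‖v - v'‖ :=
        (abs_add_le _ _).trans (add_le_add (abs_re_mul_conj_le _ _) (abs_re_mul_conj_le _ _))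
      _ ≤ ‖u - u'‖ * A + A * ‖v - v'‖ := by gcongr
      _ = _ := by ring
  have hp : ‖u‖ * ‖v‖ ≤ A * A := by gcongr
  have hp' : ‖u'‖ * ‖v'‖ ≤ A * A := by gcongr
  have h3 : |‖u‖ * ‖v‖ + ‖u'‖ * ‖v'‖| ≤ 2 * (A * A) := by
    rw [abs_of_nonneg (by positivity)]; linarith
  have h4 : |(u * conj v).re + (u' * conj v').re| ≤ 2 * (A * A) :=
    (abs_add_le _ _).trans (by linarith [abs_re_mul_conj_le u v, abs_re_mul_conj_le u' v'])
  calc |quarticForm u v - quarticForm u' v'|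
      = |(‖u‖ * ‖v‖ - ‖u'‖ * ‖v'‖) * (‖u‖ * ‖v‖ + ‖u'‖ * ‖v'‖) +
          2 * (((u * conj v).re - (u' * conj v').re) * ((u * conj v).re + (u' * conj v').re))| := by
        unfold quarticForm; congr 1; ring
    _ ≤ |‖u‖ * ‖v‖ - ‖u'‖ * ‖v'‖| * |‖u‖ * ‖v‖ + ‖u'‖ * ‖v'‖| +
          2 * (|(u * conj v).re - (u' * conj v').re| * |(u * conj v).re + (u' * conj v').re|) := by
        refine (abs_add_le _ _).trans ?_
        rw [abs_mul, abs_mul 2, abs_mul, abs_two]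
    _ ≤ A * (‖u - u'‖ + ‖v - v'‖) * (2 * (A * A)) +
          2 * (A * (‖u - u'‖ + ‖v - v'‖) * (2 * (A * A))) := by gcongr
    _ = _ := by ring

theorem quarticForm_clip_le (A : ℝ) (hA : 0 ≤ A) (u v : ℂ) :
    quarticForm (clip A u) (clip A v) ≤ quarticForm u v := by
  rw [clip, clip, quarticForm_smul]
  have h : ∀ c : ℂ, min 1 (A / ‖c‖) ^ 2 ≤ 1 := fun c =>
    pow_le_one₀ (by positivity) (min_le_left _ _)
  exact mul_le_of_le_one_left (quarticForm_nonneg u v)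
    (mul_le_one₀ (h u) (by positivity) (h v))

/-- The loss from retracting both arguments, in a form whose expectation is `O(A⁻²)`: a retracted
argument has modulus above `A`. -/
theorem quarticForm_sub_le_quarticForm_clip {A : ℝ} (hA : 0 < A) (u v : ℂ) :
    quarticForm u v - 3 * (‖u‖ ^ 6 + ‖v‖ ^ 6) / A ^ 2 ≤ quarticForm (clip A u) (clip A v) := by
  have hpos : 0 ≤ 3 * (‖u‖ ^ 6 + ‖v‖ ^ 6) / A ^ 2 := by positivity
  -- At `0` the retraction factor is the junk value `min 1 (A / 0) = 0`.
  rcases eq_or_ne u 0 with rfl | hu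
  · have : quarticForm 0 v = 0 := by simp [quarticForm]
    linarith [quarticForm_nonneg (clip A 0) (clip A v)]
  rcases eq_or_ne v 0 with rfl | hv
  · have : quarticForm u 0 = 0 := by simp [quarticForm]
    linarith [quarticForm_nonneg (clip A u) (clip A 0)]
  rw [clip, clip, quarticForm_smul]
  have h1 : ∀ c : ℂ, min 1 (A / ‖c‖) ^ 2 ≤ 1 := fun c =>
    pow_le_one₀ (by positivity) (min_le_left _ _)
  have h2 : ∀ c : ℂ, c ≠ 0 → 1 - ‖c‖ ^ 2 / A ^ 2 ≤ min 1 (A / ‖c‖) ^ 2 := by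
    intro c hc
    rcases le_total 1 (A / ‖c‖) with h | h
    · rw [min_eq_left h]
      have : 0 ≤ ‖c‖ ^ 2 / A ^ 2 := by positivity
      linarith
    · have hc' : 0 < ‖c‖ := norm_pos_iff.2 hc
      have hAc : A ≤ ‖c‖ := (div_le_one hc').1 h
      have : 1 ≤ ‖c‖ ^ 2 / A ^ 2 := by
        rw [one_le_div (by positivity)]; gcongr
      linarith [sq_nonneg (min 1 (A / ‖c‖))]
  set S := min 1 (A / ‖u‖) ^ 2
  set T := min 1 (A / ‖v‖) ^ 2
  have hST : 1 - (‖u‖ ^ 2 + ‖v‖ ^ 2) / A ^ 2 ≤ S * T := by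
    have := mul_nonneg (sub_nonneg.2 (h1 u)) (sub_nonneg.2 (h1 v))
    rw [add_div]
    linarith [h2 u hu, h2 v hv]
  have hq := quarticForm_nonneg u v
  have hq3 := quarticForm_le u v
  have hE : 0 ≤ (‖u‖ ^ 2 + ‖v‖ ^ 2) / A ^ 2 := by positivity
  have h5 : 3 * (‖u‖ ^ 2 * ‖v‖ ^ 2) * ((‖u‖ ^ 2 + ‖v‖ ^ 2) / A ^ 2) ≤
      3 * (‖u‖ ^ 6 + ‖v‖ ^ 6) / A ^ 2 := by
    rw [← mul_div_assoc]
    refine div_le_div_of_nonneg_right ?_ (by positivity)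
    nlinarith [mul_nonneg (add_nonneg (sq_nonneg ‖u‖) (sq_nonneg ‖v‖))
      (sq_nonneg (‖u‖ ^ 2 - ‖v‖ ^ 2))]
  have h6 := mul_le_mul_of_nonneg_right hST hq
  have h7 := mul_le_mul_of_nonneg_right hq3 hE
  linarith

/-- The negative part of the Hessian density minus its positive part, both truncated: `|aᵣ* x|²`
is capped at `A²` and the quartic form is evaluated at retracted arguments. -/
def truncDeficit (A : ℝ) (x z w : EuclideanSpace ℝ (Fin n)) (a : Fin n → ℂ) : ℝ :=
  min ‖sample a x‖ A ^ 2 * ‖sample a w‖ ^ 2 -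
    quarticForm (clip A (sample a z)) (clip A (sample a w))

/-- The part of `|u|²` cut off by truncating `|u|` at `A`. -/
def excess (A : ℝ) (u : ℂ) : ℝ := ‖u‖ ^ 2 - min ‖u‖ A ^ 2

theorem excess_nonneg {A : ℝ} (hA : 0 ≤ A) (u : ℂ) : 0 ≤ excess A u := by
  have : min ‖u‖ A ^ 2 ≤ ‖u‖ ^ 2 := by gcongr; exact min_le_left _ _
  unfold excess; linarith

theorem excess_le {A : ℝ} (u : ℂ) : excess A u ≤ ‖u‖ ^ 2 := by
  unfold excess; linarith [sq_nonneg (min ‖u‖ A)]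

theorem excess_le_pow_four_div {A : ℝ} (hA : 0 < A) (u : ℂ) : excess A u ≤ ‖u‖ ^ 4 / A ^ 2 := by
  unfold excess
  rcases le_total ‖u‖ A with h | h
  · rw [min_eq_left h, sub_self]; positivity
  · rw [min_eq_right h, le_div_iff₀ (by positivity)]
    have : A ^ 2 ≤ ‖u‖ ^ 2 := by gcongr
    nlinarith [sq_nonneg A, sq_nonneg ‖u‖]

/-- One summand of the Hessian form is at least minus its truncated deficit minus its excess. -/
theorem neg_truncDeficit_sub_excess_le {A : ℝ} (hA : 0 ≤ A) (x z w : EuclideanSpace ℝ (Fin n))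
    (a : Fin n → ℂ) :
    -truncDeficit A x z w a - excess A (sample a x) * ‖sample a w‖ ^ 2 ≤
      (‖sample a z‖ ^ 2 - ‖sample a x‖ ^ 2) * ‖sample a w‖ ^ 2 +
        2 * (sample a z * conj (sample a w)).re ^ 2 := by
  have := quarticForm_clip_le A hA (sample a z) (sample a w)
  unfold truncDeficit excess
  unfold quarticForm at this ⊢
  linarith

theorem sample_sub (a : Fin n → ℂ) (z z' : EuclideanSpace ℝ (Fin n)) :
    sample a (z - z') = sample a z - sample a z' := by
  simp [sample, mul_sub, Finset.sum_sub_distrib]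

theorem sample_add (a : Fin n → ℂ) (z z' : EuclideanSpace ℝ (Fin n)) :
    sample a (z + z') = sample a z + sample a z' := by
  simp [sample, mul_add, Finset.sum_add_distrib]

theorem sample_smul (a : Fin n → ℂ) (t : ℝ) (z : EuclideanSpace ℝ (Fin n)) :
    sample a (t • z) = t • sample a z := by
  simp only [sample, PiLp.smul_apply, smul_eq_mul, Complex.ofReal_mul, Complex.real_smul,
    Finset.mul_sum]
  exact Finset.sum_congr rfl fun j _ => by ring

theorem norm_sample_sq_le (a : Fin n → ℂ) (z : EuclideanSpace ℝ (Fin n)) :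
    ‖sample a z‖ ^ 2 ≤ (∑ j, ‖a j‖ ^ 2) * ‖z‖ ^ 2 := by
  have h1 : ‖sample a z‖ ≤ ∑ j, ‖a j‖ * ‖(z j : ℂ)‖ := by
    refine (norm_sum_le _ _).trans_eq ?_
    simp
  calc ‖sample a z‖ ^ 2 ≤ (∑ j, ‖a j‖ * ‖(z j : ℂ)‖) ^ 2 := by gcongr
    _ ≤ _ := Finset.sum_mul_sq_le_sq_mul_sq _ _ _
    _ = _ := by rw [← norm_sq_eq_sum_norm_coe]

theorem norm_sample_le (a : Fin n → ℂ) (z : EuclideanSpace ℝ (Fin n)) :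
    ‖sample a z‖ ≤ √(∑ j, ‖a j‖ ^ 2) * ‖z‖ := by
  rw [← Real.sqrt_sq (norm_nonneg z), ← Real.sqrt_mul (by positivity)]
  exact Real.le_sqrt_of_sq_le (norm_sample_sq_le a z)

/-- Lipschitz dependence of the truncated deficit on `(z, w)`. Thanks to the retraction the constant
grows only quadratically in the sampling vector. -/
theorem truncDeficit_sub_le {A ε : ℝ} (hA : 1 ≤ A) {x z w z' w' : EuclideanSpace ℝ (Fin n)}
    (hw : ‖w‖ = 1) (hw' : ‖w'‖ = 1) (hz : ‖z - z'‖ ≤ ε) (hww : ‖w - w'‖ ≤ ε) (a : Fin n → ℂ) :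
    truncDeficit A x z w a - truncDeficit A x z' w' a ≤
      50 * A ^ 3 * ε * (1 + ∑ j, ‖a j‖ ^ 2) := by
  have hA0 : 0 ≤ A := zero_le_one.trans hA
  have hε : 0 ≤ ε := (norm_nonneg _).trans hz
  set ρ := √(∑ j, ‖a j‖ ^ 2) with hρ
  have hρ0 : 0 ≤ ρ := Real.sqrt_nonneg _
  have hρ2 : ρ ^ 2 = ∑ j, ‖a j‖ ^ 2 := Real.sq_sqrt (by positivity)
  have hdz : ‖sample a z - sample a z'‖ ≤ ρ * ε := by
    rw [← sample_sub]; exact (norm_sample_le a _).trans (by gcongr)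
  have hdw : ‖sample a w - sample a w'‖ ≤ ρ * ε := by
    rw [← sample_sub]; exact (norm_sample_le a _).trans (by gcongr)
  have hnw : ‖sample a w‖ ≤ ρ := (norm_sample_le a w).trans_eq (by rw [hw, mul_one])
  have hnw' : ‖sample a w'‖ ≤ ρ := (norm_sample_le a w').trans_eq (by rw [hw', mul_one])
  have hc : ∀ u : ℂ, ‖clip A u‖ ≤ A := fun u => (norm_clip hA0 u).trans_le (min_le_right _ _)
  have hQ := abs_quarticForm_sub_le (hc (sample a z')) (hc (sample a w')) (hc (sample a z))
    (hc (sample a w))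
  have hQ' : 6 * A ^ 3 * (‖clip A (sample a z') - clip A (sample a z)‖ +
      ‖clip A (sample a w') - clip A (sample a w)‖) ≤ 6 * A ^ 3 * (2 * (ρ * ε) + 2 * (ρ * ε)) := by
    have e1 := norm_clip_sub_clip_le hA0 (sample a z') (sample a z)
    have e2 := norm_clip_sub_clip_le hA0 (sample a w') (sample a w)
    rw [norm_sub_rev (sample a z')] at e1
    rw [norm_sub_rev (sample a w')] at e2
    gcongr
    · linarith
    · linarith
  have hm : min ‖sample a x‖ A ^ 2 ≤ A ^ 2 := by gcongr; exact min_le_right _ _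
  have hS : ‖sample a w‖ ^ 2 - ‖sample a w'‖ ^ 2 ≤ 2 * ε * ρ ^ 2 := by
    have e1 : ‖sample a w‖ - ‖sample a w'‖ ≤ ρ * ε := (norm_sub_norm_le _ _).trans hdw
    calc ‖sample a w‖ ^ 2 - ‖sample a w'‖ ^ 2
        = (‖sample a w‖ - ‖sample a w'‖) * (‖sample a w‖ + ‖sample a w'‖) := by ring
      _ ≤ (ρ * ε) * (ρ + ρ) := by gcongr
      _ = _ := by ring
  have hmS : min ‖sample a x‖ A ^ 2 * (‖sample a w‖ ^ 2 - ‖sample a w'‖ ^ 2) ≤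
      A ^ 2 * (2 * ε * ρ ^ 2) := by
    calc _ ≤ min ‖sample a x‖ A ^ 2 * (2 * ε * ρ ^ 2) := by gcongr
      _ ≤ _ := by gcongr
  have hA23 : A ^ 2 ≤ A ^ 3 := pow_le_pow_right₀ hA (by norm_num)
  have hρ1 : 2 * ρ ≤ 1 + ρ ^ 2 := by nlinarith [sq_nonneg (ρ - 1)]
  have f1 : A ^ 2 * (2 * ε * ρ ^ 2) ≤ A ^ 3 * (2 * ε * (1 + ρ ^ 2)) := by
    gcongr; linarith
  have f2 : A ^ 3 * ε * (2 * ρ) ≤ A ^ 3 * ε * (1 + ρ ^ 2) := by gcongr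
  have f3 : 0 ≤ A ^ 3 * ε * (1 + ρ ^ 2) := by positivity
  have := le_of_abs_le hQ
  rw [← hρ2]
  unfold truncDeficit
  linarith

theorem abs_truncDeficit_le {A : ℝ} (hA : 1 ≤ A) (x z w : EuclideanSpace ℝ (Fin n))
    (a : Fin n → ℂ) : |truncDeficit A x z w a| ≤ 3 * A ^ 4 * (1 + ‖sample a w‖ ^ 2) := by
  have hA0 : 0 ≤ A := zero_le_one.trans hA
  have hm : min ‖sample a x‖ A ^ 2 ≤ A ^ 2 := by gcongr; exact min_le_right _ _
  have h24 : A ^ 2 ≤ A ^ 4 := pow_le_pow_right₀ hA (by norm_num)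
  have hc : ∀ u : ℂ, ‖clip A u‖ ≤ A := fun u => (norm_clip hA0 u).trans_le (min_le_right _ _)
  have h0 := quarticForm_nonneg (clip A (sample a z)) (clip A (sample a w))
  have h1 : quarticForm (clip A (sample a z)) (clip A (sample a w)) ≤ 3 * (A ^ 2 * A ^ 2) :=
    (quarticForm_le _ _).trans (by gcongr <;> exact hc _)
  have h2 : min ‖sample a x‖ A ^ 2 * ‖sample a w‖ ^ 2 ≤ A ^ 4 * ‖sample a w‖ ^ 2 := by
    gcongr; exact hm.trans h24
  have h3 : 0 ≤ min ‖sample a x‖ A ^ 2 * ‖sample a w‖ ^ 2 := by positivity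
  have h4 : 0 ≤ A ^ 4 * ‖sample a w‖ ^ 2 := by positivity
  have h5 : 0 ≤ A ^ 4 := by positivity
  unfold truncDeficit
  rw [abs_le]
  constructor <;> nlinarith

/-! ### Exponential tail bounds -/

/-- The Chernoff bound for a sum of independent identically distributed terms. -/
theorem measureReal_le_sum_le_exp_mul_pow {α : Type*} [MeasurableSpace α] (μ : Measure α)
    [IsProbabilityMeasure μ] (m : ℕ) (F : α → ℝ) (hF : Integrable (fun x => Real.exp (F x)) μ)
    (t : ℝ) :
    (Measure.pi fun _ : Fin m => μ).real {a | t ≤ ∑ r, F (a r)} ≤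
      Real.exp (-t) * (∫ x, Real.exp (F x) ∂μ) ^ m := by
  have hint : Integrable (fun a : Fin m → α => ∏ r, Real.exp (F (a r)))
      (Measure.pi fun _ : Fin m => μ) := Integrable.fintype_prod fun _ => hF
  have h := mul_meas_ge_le_integral_of_nonneg (μ := Measure.pi fun _ : Fin m => μ)
    (ae_of_all _ fun a => Finset.prod_nonneg fun r _ => (Real.exp_pos (F (a r))).le) hint
    (Real.exp t)
  rw [integral_fintype_prod_eq_pow (fun x => Real.exp (F x)), Fintype.card_fin] at h
  simp_rw [← Real.exp_sum, Real.exp_le_exp] at h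
  rw [Real.exp_neg, inv_mul_eq_div, le_div_iff₀ (Real.exp_pos _), mul_comm]
  exact h

theorem measureReal_exists_le {α : Type*} [MeasurableSpace α] (μ : Measure α)
    [IsProbabilityMeasure μ] (m : ℕ) (F : α → ℝ) (hF : Integrable (fun x => Real.exp (F x)) μ)
    (t : ℝ) :
    (Measure.pi fun _ : Fin m => μ).real {a | ∃ r, t ≤ F (a r)} ≤
      m * (Real.exp (-t) * ∫ x, Real.exp (F x) ∂μ) := by
  have h1 : μ.real {x | t ≤ F x} ≤ Real.exp (-t) * ∫ x, Real.exp (F x) ∂μ := by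
    have h := mul_meas_ge_le_integral_of_nonneg (ae_of_all _ fun x => (Real.exp_pos (F x)).le)
      hF (Real.exp t)
    simp_rw [Real.exp_le_exp] at h
    rw [Real.exp_neg, inv_mul_eq_div, le_div_iff₀ (Real.exp_pos _), mul_comm]
    exact h
  have h2 : ∀ r : Fin m, (Measure.pi fun _ : Fin m => μ).real {a | t ≤ F (a r)} ≤
      μ.real {x | t ≤ F x} := by
    intro r
    refine ENNReal.toReal_mono (measure_ne_top _ _) ?_
    have := Measure.le_map_apply (μ := Measure.pi fun _ : Fin m => μ)
      (measurePreserving_eval (fun _ : Fin m => μ) r).measurable.aemeasurable {x | t ≤ F x}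
    rwa [(measurePreserving_eval (fun _ : Fin m => μ) r).map_eq] at this
  rw [Set.ofPred_exists]
  calc _ ≤ ∑ r : Fin m, (Measure.pi fun _ : Fin m => μ).real {a | t ≤ F (a r)} :=
        measureReal_iUnion_fintype_le _
    _ ≤ ∑ r : Fin m, (Real.exp (-t) * ∫ x, Real.exp (F x) ∂μ) :=
        Finset.sum_le_sum fun r _ => (h2 r).trans h1
    _ = _ := by simp

/-! ### Concentration of the truncated deficit -/

@[fun_prop]
theorem measurable_clip (A : ℝ) : Measurable (clip A) := by
  unfold clip; fun_prop

@[fun_prop]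
theorem measurable_excess (A : ℝ) : Measurable (excess A) := by
  unfold excess; fun_prop

theorem measurable_quarticForm : Measurable (fun p : ℂ × ℂ => quarticForm p.1 p.2) := by
  unfold quarticForm
  have : Measurable fun p : ℂ × ℂ => (p.1 * conj p.2).re := by
    exact Complex.measurable_re.comp (by fun_prop)
  fun_prop

@[fun_prop]
theorem measurable_truncDeficit (A : ℝ) (x z w : EuclideanSpace ℝ (Fin n)) :
    Measurable (truncDeficit A x z w) := by
  unfold truncDeficit
  have : Measurable fun a : Fin n → ℂ =>
      quarticForm (clip A (sample a z)) (clip A (sample a w)) :=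
    measurable_quarticForm.comp (f := fun a : Fin n → ℂ =>
      (clip A (sample a z), clip A (sample a w))) (by fun_prop)
  fun_prop

theorem integrable_norm_sample_pow (z : EuclideanSpace ℝ (Fin n)) (k : ℕ) :
    Integrable (fun a => ‖sample a z‖ ^ (2 * k)) (complexGaussianVector n) :=
  integrable_norm_complexSample_pow _ k

theorem integrable_truncDeficit {A : ℝ} (hA : 1 ≤ A) (x z w : EuclideanSpace ℝ (Fin n)) :
    Integrable (truncDeficit A x z w) (complexGaussianVector n) := by
  refine (((integrable_const (1 : ℝ)).add (integrable_norm_sample_pow w 1)).const_mul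
    (3 * A ^ 4)).mono' (by fun_prop) (ae_of_all _ fun a => ?_)
  exact abs_truncDeficit_le hA x z w a

theorem integral_truncDeficit_le {A : ℝ} (hA : 1 ≤ A) (x z w : EuclideanSpace ℝ (Fin n)) :
    ∫ a, truncDeficit A x z w a ∂complexGaussianVector n ≤
      ‖x‖ ^ 2 * ‖w‖ ^ 2 + inner ℝ x w ^ 2 - (2 * ‖z‖ ^ 2 * ‖w‖ ^ 2 + 4 * inner ℝ z w ^ 2) +
        3 * (96 * ‖z‖ ^ 6 + 96 * ‖w‖ ^ 6) / A ^ 2 := by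
  have hA0 : 0 < A := zero_lt_one.trans_le hA
  have i1 := integrable_norm_sq_mul_norm_sq_sample x w
  have i2 := integrable_quarticForm_sample z w
  have i3 : Integrable (fun a => ‖sample a z‖ ^ 6) (complexGaussianVector n) :=
    integrable_norm_sample_pow z 3
  have i4 : Integrable (fun a => ‖sample a w‖ ^ 6) (complexGaussianVector n) :=
    integrable_norm_sample_pow w 3
  have i5 : Integrable (fun a => 3 * (‖sample a z‖ ^ 6 + ‖sample a w‖ ^ 6) / A ^ 2)
    (complexGaussianVector n) := ((i3.add i4).const_mul 3).div_const (A ^ 2)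
  have i6 : Integrable (fun a => ‖sample a x‖ ^ 2 * ‖sample a w‖ ^ 2 -
    quarticForm (sample a z) (sample a w)) (complexGaussianVector n) := i1.sub i2
  have hle : ∫ a, truncDeficit A x z w a ∂complexGaussianVector n ≤
      ∫ a, (‖sample a x‖ ^ 2 * ‖sample a w‖ ^ 2 - quarticForm (sample a z) (sample a w) +
        3 * (‖sample a z‖ ^ 6 + ‖sample a w‖ ^ 6) / A ^ 2) ∂complexGaussianVector n := by
    refine integral_mono (integrable_truncDeficit hA x z w) (i6.add i5) fun a => ?_
    have h1 := quarticForm_sub_le_quarticForm_clip hA0 (sample a z) (sample a w)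
    have h2 : min ‖sample a x‖ A ^ 2 * ‖sample a w‖ ^ 2 ≤ ‖sample a x‖ ^ 2 * ‖sample a w‖ ^ 2 := by
      gcongr; exact min_le_left _ _
    unfold truncDeficit
    linarith
  refine hle.trans ?_
  rw [integral_add i6 i5, integral_sub i1 i2, integral_div, integral_const_mul,
    integral_add i3 i4, integral_norm_sq_mul_norm_sq_sample, integral_quarticForm_sample]
  have h6 : ∀ y : EuclideanSpace ℝ (Fin n),
      ∫ a, ‖sample a y‖ ^ 6 ∂complexGaussianVector n ≤ 96 * ‖y‖ ^ 6 := by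
    intro y
    refine (integral_norm_sample_pow_le y 3).trans_eq ?_
    norm_num [Nat.factorial]
  gcongr
  exacts [h6 z, h6 w]

/-- At unit `x`, `w` and `z` within `1/24` of `x`, the expectation of the truncated deficit is
negative: `2 |z|² + 4 ⟨z, w⟩²` exceeds `1 + ⟨x, w⟩²` with room to spare for the truncation. -/
theorem integral_truncDeficit_le_neg {x z w : EuclideanSpace ℝ (Fin n)} (hx : ‖x‖ = 1)
    (hw : ‖w‖ = 1) (hz : ‖z - x‖ ≤ 1 / 24) :
    ∫ a, truncDeficit 100 x z w a ∂complexGaussianVector n ≤ -(7 / 10) := by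
  refine (integral_truncDeficit_le (by norm_num) x z w).trans ?_
  rw [hx, hw]
  have hz1 : ‖z‖ ≤ 25 / 24 := by
    have := norm_le_norm_add_norm_sub' z x
    linarith
  have hz2 : 23 / 24 ≤ ‖z‖ := by
    have := norm_le_norm_add_norm_sub z x
    linarith
  have hz6 : ‖z‖ ^ 6 ≤ (25 / 24) ^ 6 := by gcongr
  have hzz : (23 / 24 : ℝ) ^ 2 ≤ ‖z‖ ^ 2 := by gcongr
  have hd : |inner ℝ z w - inner ℝ x w| ≤ 1 / 24 := by
    rw [← inner_sub_left]
    refine (abs_real_inner_le_norm _ _).trans ?_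
    rwa [hw, mul_one]
  set q := inner ℝ z w
  set s := inner ℝ x w
  have hqs : s ^ 2 - 4 * q ^ 2 ≤ 1 / 400 := by
    obtain ⟨h1, h2⟩ := abs_le.1 hd
    have h3 : (q - s) ^ 2 ≤ (1 / 24) ^ 2 := sq_le_sq' h1 h2
    nlinarith [sq_nonneg (4 * q - (q - s)), sq_nonneg (3 * q + (q - s))]
  norm_num at hz6 hzz ⊢
  linarith

theorem exp_mul_le_of_abs_le {y W D l : ℝ} (hl : 0 ≤ l) (hW : 0 ≤ W)
    (hy : |y| ≤ D * W) (hlD : l * D ≤ 1 / 4) :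
    Real.exp (l * y) ≤ 1 + l * y + 32 * (l * D) ^ 2 * Real.exp (W / 2) := by
  have h1 : Real.exp (l * y) - (1 + l * y) ≤ |l * y| ^ 2 * Real.exp |l * y| := by
    have h := Complex.norm_exp_sub_sum_le_norm_mul_exp ((l * y : ℝ) : ℂ) 2
    rw [Finset.sum_range_succ, Finset.sum_range_one] at h
    simp only [pow_zero, Nat.factorial_zero, Nat.cast_one, div_one, pow_one, Nat.factorial_one] at h
    rw [Complex.norm_real, ← Complex.ofReal_exp] at h
    have h' : ‖((Real.exp (l * y) - (1 + l * y) : ℝ) : ℂ)‖ ≤ ‖l * y‖ ^ 2 * Real.exp ‖l * y‖ := by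
      push_cast at h ⊢; exact h
    rw [Complex.norm_real] at h'
    exact (le_abs_self _).trans h'
  have h2 : |l * y| ≤ l * D * W := by
    rw [abs_mul, abs_of_nonneg hl, mul_assoc]; gcongr
  have h3 : l * D * W ≤ W / 4 := by nlinarith
  have h4 : W ^ 2 ≤ 32 * Real.exp (W / 4) := by
    have := Real.pow_div_factorial_le_exp (W / 4) (by positivity) 2
    norm_num [Nat.factorial] at this
    linarith
  have h5 : |l * y| ^ 2 * Real.exp |l * y| ≤ 32 * (l * D) ^ 2 * Real.exp (W / 2) := by
    calc |l * y| ^ 2 * Real.exp |l * y| ≤ (l * D * W) ^ 2 * Real.exp (W / 4) := by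
          gcongr; exact h2.trans h3
      _ = (l * D) ^ 2 * W ^ 2 * Real.exp (W / 4) := by ring
      _ ≤ (l * D) ^ 2 * (32 * Real.exp (W / 4)) * Real.exp (W / 4) := by gcongr
      _ = 32 * (l * D) ^ 2 * (Real.exp (W / 4) * Real.exp (W / 4)) := by ring
      _ = _ := by rw [← Real.exp_add]; congr 2; ring
  linarith

/-- A Bernstein-type estimate: a variable dominated by `D` times one with a bounded exponential
moment satisfies `E exp (l Y) ≤ exp (l E Y + O (l² D²))` for small `l`. -/
theorem integral_exp_mul_le {α : Type*} [MeasurableSpace α] {μ : Measure α}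
    [IsProbabilityMeasure μ] {Y W : α → ℝ} {D l : ℝ} (hY : Measurable Y)
    (hl : 0 ≤ l) (hW : ∀ a, 0 ≤ W a) (hYW : ∀ a, |Y a| ≤ D * W a) (hlD : l * D ≤ 1 / 4)
    (hYi : Integrable Y μ) (hWi : Integrable (fun a => Real.exp (W a / 2)) μ)
    (hW4 : ∫ a, Real.exp (W a / 2) ∂μ ≤ 4) :
    Integrable (fun a => Real.exp (l * Y a)) μ ∧
      ∫ a, Real.exp (l * Y a) ∂μ ≤ Real.exp (l * ∫ a, Y a ∂μ + 128 * (l * D) ^ 2) := by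
  have hb : Integrable (fun a => 1 + l * Y a + 32 * (l * D) ^ 2 * Real.exp (W a / 2)) μ :=
    ((integrable_const 1).add (hYi.const_mul l)).add (hWi.const_mul _)
  have hb' : Integrable (fun a => 1 + l * Y a) μ := (integrable_const 1).add (hYi.const_mul l)
  have hle := fun a => exp_mul_le_of_abs_le hl (hW a) (hYW a) hlD
  have hi : Integrable (fun a => Real.exp (l * Y a)) μ := by
    refine hb.mono' (by fun_prop) (ae_of_all _ fun a => ?_)
    rw [Real.norm_of_nonneg (Real.exp_pos _).le]
    exact hle a
  refine ⟨hi, (integral_mono hi hb hle).trans ?_⟩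
  rw [integral_add hb' (hWi.const_mul _),
    integral_add (integrable_const 1) (hYi.const_mul l), integral_const_mul, integral_const_mul]
  simp only [integral_const, probReal_univ, smul_eq_mul, one_mul]
  have h1 := Real.add_one_le_exp (l * ∫ a, Y a ∂μ + 128 * (l * D) ^ 2)
  have h2 : 32 * (l * D) ^ 2 * ∫ a, Real.exp (W a / 2) ∂μ ≤ 32 * (l * D) ^ 2 * 4 := by gcongr
  linarith

/-- For fixed `z` and `w` the sum of the truncated deficits is at most `-3 m / 5`, except with
probability exponentially small in `m`. -/
theorem exists_measureReal_sum_truncDeficit_le :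
    ∃ c : ℝ, 0 < c ∧ ∀ (n m : ℕ) (x z w : EuclideanSpace ℝ (Fin n)), ‖x‖ = 1 → ‖w‖ = 1 →
      ‖z - x‖ ≤ 1 / 24 →
      (Measure.pi fun _ : Fin m => complexGaussianVector n).real
        {a | -(3 / 5 * m) ≤ ∑ r, truncDeficit 100 x z w (a r)} ≤ Real.exp (-(c * m)) := by
  -- `D` bounds the deficit, and `l` makes the second-order term of the moment generating function
  -- small against the first-order one.
  obtain ⟨D, hD⟩ : ∃ D : ℝ, D = 3 * 100 ^ 4 := ⟨_, rfl⟩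
  have hD0 : 1 ≤ D := by rw [hD]; norm_num
  obtain ⟨l, hl⟩ : ∃ l : ℝ, l = 1 / (2560 * D ^ 2) := ⟨_, rfl⟩
  have hl0 : 0 < l := by rw [hl]; positivity
  have hlD2 : l * D ^ 2 = 1 / 2560 := by rw [hl]; field_simp
  have hlD : l * D ≤ 1 / 4 := by nlinarith
  refine ⟨l / 20, by positivity, fun n m x z w hx hw hz => ?_⟩
  have hsplit : ∀ a : Fin n → ℂ, Real.exp ((1 + ‖sample a w‖ ^ 2) / 2) =
      Real.exp (1 / 2) * Real.exp (‖sample a w‖ ^ 2 / 2) := fun a => by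
    rw [← Real.exp_add]; congr 1; ring
  have hWi : Integrable (fun a => Real.exp ((1 + ‖sample a w‖ ^ 2) / 2))
      (complexGaussianVector n) := by
    simp_rw [hsplit]; exact (integrable_exp_half_sample hw).const_mul _
  have hW4 : ∫ a, Real.exp ((1 + ‖sample a w‖ ^ 2) / 2) ∂complexGaussianVector n ≤ 4 := by
    simp_rw [hsplit]
    rw [integral_const_mul, integral_exp_half_sample hw]
    have h1 : Real.exp (1 / 2) ^ 2 < 2 ^ 2 := by
      rw [← Real.exp_nat_mul]
      norm_num
      linarith [Real.exp_one_lt_d9]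
    have h2 := lt_of_pow_lt_pow_left₀ 2 (by norm_num) h1
    linarith
  obtain ⟨hi, hle⟩ := integral_exp_mul_le (measurable_truncDeficit 100 x z w) hl0.le
    (fun a => by positivity)
    (fun a => by rw [hD]; exact abs_truncDeficit_le (by norm_num) x z w a) hlD
    (integrable_truncDeficit (by norm_num) x z w) hWi hW4
  have hmgf : ∫ a, Real.exp (l * truncDeficit 100 x z w a) ∂complexGaussianVector n ≤
      Real.exp (-(13 / 20 * l)) := by
    refine hle.trans (Real.exp_le_exp.2 ?_)
    have h1 := mul_le_mul_of_nonneg_left (integral_truncDeficit_le_neg hx hw hz) hl0.le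
    have h2 : (l * D) ^ 2 = l * (1 / 2560) := by rw [← hlD2]; ring
    rw [h2]
    linarith
  have hch := measureReal_le_sum_le_exp_mul_pow (complexGaussianVector n) m
    (fun a => l * truncDeficit 100 x z w a) hi (l * -(3 / 5 * m))
  have hset : {a : Fin m → Fin n → ℂ | -(3 / 5 * (m : ℝ)) ≤ ∑ r, truncDeficit 100 x z w (a r)} =
      {a | l * -(3 / 5 * m) ≤ ∑ r, l * truncDeficit 100 x z w (a r)} := by
    ext a
    simp only [Set.mem_ofPred_eq, ← Finset.mul_sum, mul_le_mul_iff_right₀ hl0]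
  rw [hset]
  refine hch.trans ?_
  calc _ ≤ Real.exp (-(l * -(3 / 5 * m))) * Real.exp (-(13 / 20 * l)) ^ m := by
        gcongr
    _ = _ := by
        rw [← Real.exp_nat_mul, ← Real.exp_add]; ring_nf

/-- The mean of `∑ⱼ |aᵣⱼ|²` over the samples is below `4 n`, except with probability
`exp (-m n)`. -/
theorem measureReal_energy_le (n m : ℕ) :
    (Measure.pi fun _ : Fin m => complexGaussianVector n).real
      {a | 4 * m * n ≤ ∑ r, ∑ j, ‖a r j‖ ^ 2} ≤ Real.exp (-(m * n)) := by
  have hexp : ∀ a : Fin n → ℂ, Real.exp (∑ j, ‖a j‖ ^ 2 / 2) = ∏ j, Real.exp (‖a j‖ ^ 2 / 2) :=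
    fun a => Real.exp_sum _ _
  have hi : Integrable (fun a : Fin n → ℂ => Real.exp (∑ j, ‖a j‖ ^ 2 / 2))
      (complexGaussianVector n) := by
    simp_rw [hexp]
    exact Integrable.fintype_prod (f := fun _ (c : ℂ) => Real.exp (‖c‖ ^ 2 / 2))
      fun _ => integrable_exp_half_complexGaussian
  have hint : ∫ a : Fin n → ℂ, Real.exp (∑ j, ‖a j‖ ^ 2 / 2) ∂complexGaussianVector n = 2 ^ n := by
    simp_rw [hexp]
    rw [complexGaussianVector, integral_fintype_prod_eq_pow (fun c : ℂ => Real.exp (‖c‖ ^ 2 / 2)),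
      integral_exp_half_complexGaussian, Fintype.card_fin]
  have h := measureReal_le_sum_le_exp_mul_pow (complexGaussianVector n) m _ hi (2 * m * n)
  have hset : {a : Fin m → Fin n → ℂ | 4 * (m : ℝ) * n ≤ ∑ r, ∑ j, ‖a r j‖ ^ 2} =
      {a | 2 * (m : ℝ) * n ≤ ∑ r, ∑ j, ‖a r j‖ ^ 2 / 2} := by
    ext a
    simp only [Set.mem_ofPred_eq, ← Finset.sum_div]
    constructor <;> intro h <;> linarith
  rw [hset]
  refine h.trans ?_
  rw [hint]
  have h2 : (2 : ℝ) ≤ Real.exp 1 := by linarith [Real.exp_one_gt_d9]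
  calc Real.exp (-(2 * m * n)) * ((2 : ℝ) ^ n) ^ m
      ≤ Real.exp (-(2 * m * n)) * (Real.exp 1 ^ n) ^ m := by gcongr
    _ = _ := by
        rw [← Real.exp_nat_mul, ← Real.exp_nat_mul, ← Real.exp_add]; congr 1; ring

/-! ### Uniform control of the truncated deficit -/

/-- Simultaneously for all `z` near `x` and all unit `w`, the truncated deficit has a sample mean
of at most `-1/2`. Since the deficit is Lipschitz in `(z, w)` only up to the factor `∑ⱼ |aⱼ|² ≈ n`,
the net has mesh of order `1 / n`, and the union bound costs `exp (O (n log n))`. -/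
theorem exists_measureReal_truncDeficit_uniform_le :
    ∃ C : ℝ, 0 < C ∧ ∃ c : ℝ, 0 < c ∧ ∀ n m : ℕ, 2 ≤ n → C * n * Real.log n ≤ m →
      ∀ x : EuclideanSpace ℝ (Fin n), ‖x‖ = 1 →
      (Measure.pi fun _ : Fin m => complexGaussianVector n).real
        {a | ¬ ∀ z : EuclideanSpace ℝ (Fin n), ‖z - x‖ ≤ 1 / 24 →
          ∀ w : EuclideanSpace ℝ (Fin n), ‖w‖ = 1 →
            ∑ r, truncDeficit 100 x z w (a r) ≤ -(1 / 2 * m)} ≤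
        Real.exp (-(m * n)) + Real.exp (-(c * m)) := by
  obtain ⟨c, hc, hconc⟩ := exists_measureReal_sum_truncDeficit_le
  -- The mesh `1 / (K n)` turns the Lipschitz bound `50 * 100 ^ 3 * (m + 4 m n)`, at most
  -- `250 * 100 ^ 3 * m n`, into `m / 10`.
  obtain ⟨K, hK⟩ : ∃ K : ℝ, K = 2500000000 := ⟨_, rfl⟩
  have hK0 : 1 ≤ K := by rw [hK]; norm_num
  have hlog2 : 0 < Real.log 2 := Real.log_pos one_lt_two
  have hlogK : 0 ≤ Real.log (5 * K) := Real.log_nonneg (by linarith)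
  set b := Real.log (5 * K) / Real.log 2 + 1 with hb
  have hb0 : 0 < b := by positivity
  refine ⟨4 * b / c, by positivity, c / 2, by positivity, fun n m hn hm x hx => ?_⟩
  have hn1 : (2 : ℝ) ≤ n := by exact_mod_cast hn
  have hn0 : (0 : ℝ) < n := by linarith
  set ε : ℝ := 1 / (K * n) with hε
  have hε0 : 0 < ε := by positivity
  obtain ⟨Nz, hNz, hNz', hNzc⟩ := exists_finset_net (R := 2) zero_le_two hε0
    (Metric.closedBall x (1 / 24)) fun z hz => by
      rw [mem_closedBall_iff_norm] at hz
      linarith [norm_le_norm_add_norm_sub' z x]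
  obtain ⟨Nw, hNw, hNw', hNwc⟩ := exists_finset_net (R := 2) zero_le_two hε0
    (Metric.sphere (0 : EuclideanSpace ℝ (Fin n)) 1) fun w hw => by
      rw [mem_sphere_zero_iff_norm] at hw
      linarith
  rw [finrank_euclideanSpace_fin] at hNzc hNwc
  have hsub : {a : Fin m → Fin n → ℂ | ¬ ∀ z : EuclideanSpace ℝ (Fin n), ‖z - x‖ ≤ 1 / 24 →
          ∀ w : EuclideanSpace ℝ (Fin n), ‖w‖ = 1 →
            ∑ r, truncDeficit 100 x z w (a r) ≤ -(1 / 2 * m)} ⊆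
      {a | 4 * m * n ≤ ∑ r, ∑ j, ‖a r j‖ ^ 2} ∪
      ⋃ p ∈ Nz ×ˢ Nw, {a | -(3 / 5 * m) ≤ ∑ r, truncDeficit 100 x p.1 p.2 (a r)} := by
    intro a ha
    by_contra hcon
    refine ha fun z hz w hw => ?_
    simp only [Set.mem_union, Set.mem_ofPred_eq, Set.mem_iUnion, not_or, not_le, not_exists,
      Finset.mem_product] at hcon
    obtain ⟨hen, hnet⟩ := hcon
    obtain ⟨z', hz'N, hz'⟩ := hNz' z (mem_closedBall_iff_norm.2 hz)
    obtain ⟨w', hw'N, hw'⟩ := hNw' w (mem_sphere_zero_iff_norm.2 hw)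
    have hw'1 : ‖w'‖ = 1 := mem_sphere_zero_iff_norm.1 (hNw w' hw'N)
    have h1 := hnet (z', w') ⟨hz'N, hw'N⟩
    have h2 : ∑ r, (truncDeficit 100 x z w (a r) - truncDeficit 100 x z' w' (a r)) ≤
        ∑ r, 50 * 100 ^ 3 * ε * (1 + ∑ j, ‖a r j‖ ^ 2) :=
      Finset.sum_le_sum fun r _ => truncDeficit_sub_le (by norm_num) hw hw'1 hz' hw' (a r)
    rw [Finset.sum_sub_distrib, ← Finset.mul_sum, Finset.sum_add_distrib] at h2
    simp only [Finset.sum_const, Finset.card_univ, Fintype.card_fin, nsmul_eq_mul, mul_one] at h2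
    have h3 : (m : ℝ) + ∑ r, ∑ j, ‖a r j‖ ^ 2 ≤ 5 * n * m := by
      have : (m : ℝ) * 1 ≤ m * n := by gcongr; linarith
      linarith
    have h4 : 50 * 100 ^ 3 * ε * ((m : ℝ) + ∑ r, ∑ j, ‖a r j‖ ^ 2) ≤ 1 / 10 * m := by
      calc _ ≤ 50 * 100 ^ 3 * ε * (5 * n * m) := by gcongr
        _ = _ := by rw [hε, hK]; field_simp; ring
    linarith
  have hcard : ((Nz ×ˢ Nw).card : ℝ) ≤ Real.exp (2 * b * (n * Real.log n)) := by
    have h1 : 1 + 2 * 2 / ε ≤ 5 * K * n := by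
      have : 1 ≤ K * n := by nlinarith
      rw [hε, div_div_eq_mul_div, div_one]
      linarith
    have hlogn : Real.log 2 ≤ Real.log n := Real.log_le_log two_pos hn1
    have h2 : Real.log (5 * K * n) ≤ b * Real.log n := by
      rw [Real.log_mul (by positivity) hn0.ne', hb, add_mul, one_mul]
      gcongr
      rw [div_mul_eq_mul_div, le_div_iff₀ hlog2]
      gcongr
    have h3 : ((1 + 2 * 2 / ε) ^ n : ℝ) ≤ Real.exp (b * (n * Real.log n)) := by
      calc ((1 + 2 * 2 / ε) ^ n : ℝ) ≤ (5 * K * n) ^ n := by gcongr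
        _ = Real.exp (Real.log (5 * K * n)) ^ n := by rw [Real.exp_log (by positivity)]
        _ = Real.exp (n * Real.log (5 * K * n)) := by rw [← Real.exp_nat_mul]
        _ ≤ Real.exp (n * (b * Real.log n)) := by gcongr
        _ = _ := by ring_nf
    rw [Finset.card_product, Nat.cast_mul]
    calc (Nz.card : ℝ) * Nw.card
        ≤ Real.exp (b * (n * Real.log n)) * Real.exp (b * (n * Real.log n)) := by
          gcongr
          exacts [hNzc.trans h3, hNwc.trans h3]
      _ = _ := by rw [← Real.exp_add]; ring_nf
  refine (measureReal_mono hsub).trans ((measureReal_union_le _ _).trans ?_)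
  gcongr
  · exact measureReal_energy_le n m
  · refine (measureReal_biUnion_finset_le _ _).trans ?_
    calc _ ≤ ∑ p ∈ Nz ×ˢ Nw, Real.exp (-(c * m)) := by
          refine Finset.sum_le_sum fun p hp => ?_
          obtain ⟨hp1, hp2⟩ := Finset.mem_product.1 hp
          exact hconc n m x p.1 p.2 hx (mem_sphere_zero_iff_norm.1 (hNw _ hp2))
            (mem_closedBall_iff_norm.1 (hNz _ hp1))
      _ = (Nz ×ˢ Nw).card * Real.exp (-(c * m)) := by simp
      _ ≤ Real.exp (2 * b * (n * Real.log n)) * Real.exp (-(c * m)) := by gcongr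
      _ ≤ Real.exp (-(c / 2 * m)) := by
          rw [← Real.exp_add, Real.exp_le_exp]
          have : 4 * b / c * n * Real.log n * (c / 2) ≤ m * (c / 2) := by gcongr
          have e : 4 * b / c * n * Real.log n * (c / 2) = 2 * b * (n * Real.log n) := by
            field_simp
            ring
          linarith

/-! ### Uniform control of the excess -/

/-- The excess capped at `B`: zero as soon as `|u|² > B`. -/
def cappedExcess (A B : ℝ) (u : ℂ) : ℝ := if ‖u‖ ^ 2 ≤ B then excess A u else 0

theorem cappedExcess_nonneg {A : ℝ} (hA : 0 ≤ A) (B : ℝ) (u : ℂ) : 0 ≤ cappedExcess A B u := by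
  unfold cappedExcess; split_ifs
  exacts [excess_nonneg hA u, le_rfl]

theorem cappedExcess_le {A B : ℝ} (hB : 0 ≤ B) (u : ℂ) : cappedExcess A B u ≤ B := by
  unfold cappedExcess; split_ifs with h
  exacts [(excess_le u).trans h, hB]

theorem cappedExcess_le_excess {A : ℝ} (hA : 0 ≤ A) (B : ℝ) (u : ℂ) :
    cappedExcess A B u ≤ excess A u := by
  unfold cappedExcess; split_ifs
  exacts [le_rfl, excess_nonneg hA u]

@[fun_prop]
theorem measurable_cappedExcess (A B : ℝ) : Measurable (cappedExcess A B) := by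
  unfold cappedExcess
  exact Measurable.ite (measurableSet_le (by fun_prop) measurable_const) (by fun_prop)
    measurable_const

/-- The exponential moment of a capped excess term. The cap keeps the exponent below `|a* w|² / 8`,
and the expectation is small because the excess is at most `|a* x|⁴ / A²`. -/
theorem integral_exp_cappedExcess_le {B l : ℝ} (hl : 0 < l) (hlB : l * B = 1 / 8)
    {x w : EuclideanSpace ℝ (Fin n)} (hx : ‖x‖ = 1) (hw : ‖w‖ = 1) :
    Integrable (fun a => Real.exp (l * (cappedExcess 100 B (sample a x) * ‖sample a w‖ ^ 2)))
      (complexGaussianVector n) ∧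
    ∫ a, Real.exp (l * (cappedExcess 100 B (sample a x) * ‖sample a w‖ ^ 2))
      ∂complexGaussianVector n ≤ Real.exp (l / 20) := by
  have hB : 0 ≤ B := by
    by_contra! h
    have := mul_neg_of_pos_of_neg hl h
    linarith
  have h100 : (0 : ℝ) ≤ 100 := by norm_num
  have hpt : ∀ a : Fin n → ℂ,
      Real.exp (l * (cappedExcess 100 B (sample a x) * ‖sample a w‖ ^ 2)) ≤
        1 + l / 20000 * (‖sample a x‖ ^ 8 + 32 * Real.exp (‖sample a w‖ ^ 2 / 2)) := by
    intro a
    set p := cappedExcess 100 B (sample a x)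
    set U := ‖sample a x‖ ^ 4
    set V := ‖sample a w‖ ^ 2
    have hV : 0 ≤ V := by positivity
    have hp0 : 0 ≤ p := cappedExcess_nonneg h100 B _
    have hpB : p ≤ B := cappedExcess_le hB _
    have hpU : p ≤ U / 100 ^ 2 :=
      (cappedExcess_le_excess h100 B _).trans (excess_le_pow_four_div (by norm_num) _)
    have hF0 : 0 ≤ l * (p * V) := by positivity
    have hF : l * (p * V) ≤ V / 8 := by
      calc l * (p * V) ≤ l * (B * V) := by gcongr
        _ = V / 8 := by rw [← mul_assoc, hlB]; ring
    have h1 : Real.exp (l * (p * V)) ≤ 1 + l * (p * V) * Real.exp (l * (p * V)) := by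
      have := Real.add_one_le_exp (-(l * (p * V)))
      have h2 := mul_le_mul_of_nonneg_right this (Real.exp_pos (l * (p * V))).le
      rw [← Real.exp_add, neg_add_cancel, Real.exp_zero] at h2
      linarith
    have h3 : U * (V * Real.exp (V / 8)) ≤ (U ^ 2 + 32 * Real.exp (V / 2)) / 2 := by
      have e1 : V ^ 2 ≤ 32 * Real.exp (V / 4) := by
        have := Real.pow_div_factorial_le_exp (V / 4) (by positivity) 2
        norm_num [Nat.factorial] at this
        linarith
      have e2 : (V * Real.exp (V / 8)) ^ 2 ≤ 32 * Real.exp (V / 2) := by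
        calc (V * Real.exp (V / 8)) ^ 2 = V ^ 2 * Real.exp (V / 4) := by
              rw [mul_pow, ← Real.exp_nat_mul]; congr 2; push_cast; ring
          _ ≤ 32 * Real.exp (V / 4) * Real.exp (V / 4) := by gcongr
          _ = _ := by rw [mul_assoc, ← Real.exp_add]; congr 2; ring
      linarith [two_mul_le_add_sq U (V * Real.exp (V / 8))]
    have h4 : l * (p * V) * Real.exp (l * (p * V)) ≤
        l / 20000 * (U ^ 2 + 32 * Real.exp (V / 2)) := by
      calc l * (p * V) * Real.exp (l * (p * V)) ≤ l * (U / 100 ^ 2 * V) * Real.exp (V / 8) := by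
            gcongr
        _ = l / 10000 * (U * (V * Real.exp (V / 8))) := by ring
        _ ≤ l / 10000 * ((U ^ 2 + 32 * Real.exp (V / 2)) / 2) := by gcongr
        _ = _ := by ring
    have h5 : ‖sample a x‖ ^ 8 = U ^ 2 := by rw [← pow_mul]
    rw [h5]
    linarith
  have i1 : Integrable (fun a => ‖sample a x‖ ^ 8) (complexGaussianVector n) :=
    integrable_norm_sample_pow x 4
  have i2 := (integrable_exp_half_sample hw).const_mul 32
  have i3 : Integrable (fun a => l / 20000 * (‖sample a x‖ ^ 8 +
      32 * Real.exp (‖sample a w‖ ^ 2 / 2))) (complexGaussianVector n) :=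
    (i1.add i2).const_mul (l / 20000)
  have hi : Integrable (fun a =>
      Real.exp (l * (cappedExcess 100 B (sample a x) * ‖sample a w‖ ^ 2)))
      (complexGaussianVector n) := by
    refine ((integrable_const (1 : ℝ)).add i3).mono' (by fun_prop) (ae_of_all _ fun a => ?_)
    rw [Real.norm_of_nonneg (Real.exp_pos _).le]
    exact hpt a
  refine ⟨hi, (integral_mono hi ((integrable_const (1 : ℝ)).add i3) hpt).trans ?_⟩
  have hval : ∫ a, (1 + l / 20000 * (‖sample a x‖ ^ 8 + 32 * Real.exp (‖sample a w‖ ^ 2 / 2)))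
      ∂complexGaussianVector n = 1 + l / 20000 *
        (∫ a, ‖sample a x‖ ^ 8 ∂complexGaussianVector n + 32 * 2) := by
    rw [integral_add (integrable_const _) i3, integral_const_mul, integral_add i1 i2,
      integral_const_mul, integral_exp_half_sample hw]
    simp
  have h8 : ∫ a, ‖sample a x‖ ^ 8 ∂complexGaussianVector n ≤ 768 := by
    refine (integral_norm_sample_pow_le x 4).trans_eq ?_
    rw [hx]
    norm_num [Nat.factorial]
  have h9 := Real.add_one_le_exp (l / 20)
  simp only [Pi.add_apply] at hval ⊢
  rw [hval]
  nlinarith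

/-- Uniform bound for the part of `∑ᵣ |aᵣ* x|² |aᵣ* w|²` cut off by the truncation. -/
theorem measureReal_excess_uniform_le (m : ℕ) {B : ℝ} (hB : 0 < B)
    {x : EuclideanSpace ℝ (Fin n)} (hx : ‖x‖ = 1) :
    (Measure.pi fun _ : Fin m => complexGaussianVector n).real
      {a | ¬ ∀ w : EuclideanSpace ℝ (Fin n), ‖w‖ = 1 →
        ∑ r, excess 100 (sample (a r) x) * ‖sample (a r) w‖ ^ 2 ≤ 2 / 5 * m} ≤
      m * (Real.exp (-(B / 2)) * 2) + 5 ^ n * Real.exp (-(m / (160 * B))) := by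
  have h100 : (0 : ℝ) ≤ 100 := by norm_num
  obtain ⟨N, hN, hN', hNc⟩ := exists_finset_net (R := 1) (ε := 1 / 2) zero_le_one (by norm_num)
    (Metric.sphere (0 : EuclideanSpace ℝ (Fin n)) 1) fun w hw =>
      (mem_sphere_zero_iff_norm.1 hw).le
  rw [finrank_euclideanSpace_fin] at hNc
  have hsub : {a : Fin m → Fin n → ℂ | ¬ ∀ w : EuclideanSpace ℝ (Fin n), ‖w‖ = 1 →
        ∑ r, excess 100 (sample (a r) x) * ‖sample (a r) w‖ ^ 2 ≤ 2 / 5 * m} ⊆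
      {a | ∃ r, B / 2 ≤ ‖sample (a r) x‖ ^ 2 / 2} ∪
      ⋃ w ∈ N, {a | 1 / (8 * B) * (m / 10) ≤ ∑ r, 1 / (8 * B) *
        (cappedExcess 100 B (sample (a r) x) * ‖sample (a r) w‖ ^ 2)} := by
    intro a ha
    by_contra hcon
    refine ha fun w hw => ?_
    simp only [Set.mem_union, Set.mem_ofPred_eq, Set.mem_iUnion, not_or, not_le,
      not_exists] at hcon
    obtain ⟨hmax, hnet⟩ := hcon
    have hcap : ∀ r, cappedExcess 100 B (sample (a r) x) = excess 100 (sample (a r) x) := by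
      intro r
      rw [cappedExcess, if_pos]
      linarith [hmax r]
    let L : EuclideanSpace ℝ (Fin n) →L[ℝ] EuclideanSpace ℂ (Fin m) :=
      LinearMap.toContinuousLinearMap
        { toFun := fun v => WithLp.toLp 2 fun r =>
            √(excess 100 (sample (a r) x)) • sample (a r) v
          map_add' := fun v v' => by ext r; simp [sample_add]
          map_smul' := fun t v => by ext r; simp [sample_smul]; ring }
    have hL : ∀ v, ‖L v‖ ^ 2 = ∑ r, excess 100 (sample (a r) x) * ‖sample (a r) v‖ ^ 2 := by
      intro v
      rw [EuclideanSpace.norm_sq_eq]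
      refine Finset.sum_congr rfl fun r _ => ?_
      change ‖√(excess 100 (sample (a r) x)) • sample (a r) v‖ ^ 2 = _
      rw [norm_smul, mul_pow, Real.norm_eq_abs, sq_abs, Real.sq_sqrt (excess_nonneg h100 _)]
    have hLN : ∀ v ∈ (N : Set (EuclideanSpace ℝ (Fin n))), ‖L v‖ ≤ √((m : ℝ) / 10) := by
      intro v hv
      refine Real.le_sqrt_of_sq_le ?_
      have h1 := hnet v hv
      rw [← Finset.mul_sum, mul_lt_mul_iff_right₀ (by positivity)] at h1
      rw [hL]
      simp only [hcap] at h1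
      exact h1.le
    have hnorm := norm_le_two_mul_of_net L (Real.sqrt_nonneg _) N
      (fun v hv => hN' v (mem_sphere_zero_iff_norm.2 hv)) hLN
    have hLw : ‖L w‖ ≤ 2 * √((m : ℝ) / 10) :=
      (L.le_opNorm w).trans (by rw [hw, mul_one]; exact hnorm)
    rw [← hL]
    calc ‖L w‖ ^ 2 ≤ (2 * √((m : ℝ) / 10)) ^ 2 := by gcongr
      _ = _ := by rw [mul_pow, Real.sq_sqrt (by positivity)]; ring
  refine (measureReal_mono hsub).trans ((measureReal_union_le _ _).trans ?_)
  gcongr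
  · have := measureReal_exists_le (complexGaussianVector n) m _ (integrable_exp_half_sample hx)
      (B / 2)
    rwa [integral_exp_half_sample hx] at this
  · refine (measureReal_biUnion_finset_le _ _).trans ?_
    calc _ ≤ ∑ w ∈ N, Real.exp (-(m / (160 * B))) := by
          refine Finset.sum_le_sum fun w hw => ?_
          have hl : 0 < 1 / (8 * B) := by positivity
          obtain ⟨hi, hle⟩ := integral_exp_cappedExcess_le (B := B) hl (by field_simp) hx
            (mem_sphere_zero_iff_norm.1 (hN w hw))
          refine (measureReal_le_sum_le_exp_mul_pow (complexGaussianVector n) m _ hi _).trans ?_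
          calc _ ≤ Real.exp (-(1 / (8 * B) * (m / 10))) * Real.exp (1 / (8 * B) / 20) ^ m := by
                gcongr
            _ = _ := by
                rw [← Real.exp_nat_mul, ← Real.exp_add]
                congr 1
                field_simp
                ring
      _ = N.card * Real.exp (-(m / (160 * B))) := by simp
      _ ≤ 5 ^ n * Real.exp (-(m / (160 * B))) := by
          gcongr
          refine hNc.trans_eq ?_
          norm_num

/-! ### The exponent `min (m / n) √m` -/

/-- In the regime `m ≥ C n log n` the exponent `min (m / n) √m` dominates any multiple of
`log m`. -/
theorem exists_forall_mul_log_le_min (K : ℝ) (hK : 1 ≤ K) :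
    ∃ C : ℝ, 0 < C ∧ ∀ n m : ℕ, 2 ≤ n → C * n * Real.log n ≤ m →
      5 ≤ m ∧ K * Real.log m ≤ min ((m : ℝ) / n) √m := by
  have hK0 : 0 < K := by linarith
  refine ⟨max ((4 * K) ^ 4) (2 * K), by positivity, fun n m hn hm => ?_⟩
  have hn1 : (2 : ℝ) ≤ n := by exact_mod_cast hn
  have hn0 : (0 : ℝ) < n := by linarith
  have hlog2 : 1 / 2 ≤ Real.log 2 := by linarith [Real.log_two_gt_d9]
  have hlogn : 1 / 2 ≤ Real.log n := hlog2.trans (Real.log_le_log two_pos hn1)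
  have hC : (4 * K) ^ 4 ≤ m := by
    calc (4 * K) ^ 4 ≤ max ((4 * K) ^ 4) (2 * K) * (2 * (1 / 2)) := by
          rw [mul_one_div_cancel two_ne_zero, mul_one]; exact le_max_left _ _
      _ ≤ max ((4 * K) ^ 4) (2 * K) * (n * Real.log n) := by gcongr
      _ ≤ m := by rw [← mul_assoc]; exact hm
  have hm5 : (5 : ℝ) ≤ m := by
    have : (4 * 1 : ℝ) ^ 4 ≤ (4 * K) ^ 4 := by gcongr
    norm_num at this
    linarith
  have hm0 : (0 : ℝ) < m := by linarith
  have hsqrt : K * Real.log m ≤ √m := by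
    set s := √√(m : ℝ) with hs
    have hs0 : 0 ≤ s := Real.sqrt_nonneg _
    have hs2 : s ^ 2 = √m := Real.sq_sqrt (Real.sqrt_nonneg _)
    have hs4 : s ^ 4 = m := by
      rw [show 4 = 2 * 2 from rfl, pow_mul, hs2, Real.sq_sqrt hm0.le]
    have h1 : 4 * K ≤ s := by
      refine le_of_pow_le_pow_left₀ four_ne_zero hs0 ?_
      rwa [hs4]
    have h2 : Real.log m ≤ 4 * s := by
      rw [← hs4, Real.log_pow]
      push_cast
      have := Real.log_le_self hs0
      linarith
    rw [← hs2]
    calc K * Real.log m ≤ K * (4 * s) := by gcongr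
      _ = (4 * K) * s := by ring
      _ ≤ s * s := by gcongr
      _ = s ^ 2 := by ring
  refine ⟨by exact_mod_cast hm5, le_min ?_ hsqrt⟩
  rcases le_total ((n : ℝ) ^ 2) m with h | h
  · refine hsqrt.trans ?_
    rw [le_div_iff₀ hn0]
    have : (n : ℝ) ≤ √m := Real.le_sqrt_of_sq_le h
    calc √(m : ℝ) * n ≤ √m * √m := by gcongr
      _ = m := Real.mul_self_sqrt hm0.le
  · have h1 : Real.log m ≤ 2 * Real.log n := by
      have := Real.log_le_log hm0 h
      rwa [Real.log_pow] at this
    rw [le_div_iff₀ hn0]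
    calc K * Real.log m * n ≤ K * (2 * Real.log n) * n := by gcongr
      _ = 2 * K * n * Real.log n := by ring
      _ ≤ max ((4 * K) ^ 4) (2 * K) * n * Real.log n := by gcongr; exact le_max_right _ _
      _ ≤ m := hm

/-! ### Nonnegativity of the Hessian form -/

/-- The quadratic form of the Hessian at `z` in the direction `w` for the data of `x`, without its
factor `1 / m`. -/
def hessianSum {m : ℕ} (a : Fin m → Fin n → ℂ) (x z w : EuclideanSpace ℝ (Fin n)) : ℝ :=
  ∑ r, ((‖sample (a r) z‖ ^ 2 - ‖sample (a r) x‖ ^ 2) * ‖sample (a r) w‖ ^ 2 +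
    2 * (sample (a r) z * conj (sample (a r) w)).re ^ 2)

theorem quadForm_hessian_intensity {m : ℕ} (a : Fin m → Fin n → ℂ)
    (x z w : EuclideanSpace ℝ (Fin n)) :
    (w : Fin n → ℝ) ⬝ᵥ (hessian a (intensity a x) z *ᵥ (w : Fin n → ℝ)) =
      1 / (m : ℝ) * hessianSum a x z w :=
  quadForm_hessian a (intensity a x) z w

theorem hessianSum_nonneg_of_le {m : ℕ} {a : Fin m → Fin n → ℂ}
    {x z w : EuclideanSpace ℝ (Fin n)}
    (h1 : ∑ r, truncDeficit 100 x z w (a r) ≤ -(1 / 2 * m))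
    (h2 : ∑ r, excess 100 (sample (a r) x) * ‖sample (a r) w‖ ^ 2 ≤ 2 / 5 * m) :
    0 ≤ hessianSum a x z w := by
  have h3 : ∑ r, (-truncDeficit 100 x z w (a r) -
      excess 100 (sample (a r) x) * ‖sample (a r) w‖ ^ 2) ≤ hessianSum a x z w :=
    Finset.sum_le_sum fun r _ => neg_truncDeficit_sub_excess_le (by norm_num) x z w (a r)
  rw [Finset.sum_sub_distrib, Finset.sum_neg_distrib] at h3
  have : (0 : ℝ) ≤ m := Nat.cast_nonneg m
  linarith

/-- The union bound for a unit signal. The excess is capped at `s / 1280`, where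
`s = min (m / n) √m`; since `s n ≤ m` and `s² ≤ m`, this makes the excess bound beat `5 ^ n`. -/
theorem exists_measureReal_hessianSum_neg_le :
    ∃ C : ℝ, 0 < C ∧ ∃ γ : ℝ, 0 < γ ∧ ∀ n m : ℕ, 2 ≤ n → C * n * Real.log n ≤ m →
      ∀ x : EuclideanSpace ℝ (Fin n), ‖x‖ = 1 →
      (Measure.pi fun _ : Fin m => complexGaussianVector n).real
        {a | ¬ ∀ z : EuclideanSpace ℝ (Fin n), ‖z - x‖ ≤ 1 / 24 →
          ∀ w : EuclideanSpace ℝ (Fin n), ‖w‖ = 1 → 0 ≤ hessianSum a x z w} ≤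
        Real.exp (-(γ * min ((m : ℝ) / n) √m)) := by
  obtain ⟨C₁, hC₁, c, hc, hdef⟩ := exists_measureReal_truncDeficit_uniform_le
  set g := min c (1 / 2560) with hg
  have hg0 : 0 < g := by positivity
  have hgc : g ≤ c := min_le_left _ _
  have hg1 : g ≤ 1 / 2560 := min_le_right _ _
  obtain ⟨C₂, hC₂, hlog⟩ := exists_forall_mul_log_le_min (4 / g) (by
    rw [one_le_div hg0]; linarith)
  refine ⟨max C₁ C₂, by positivity, g / 2, by positivity, fun n m hn hm x hx => ?_⟩
  have hn1 : (2 : ℝ) ≤ n := by exact_mod_cast hn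
  have hn0 : (0 : ℝ) < n := by linarith
  have hlogn : 0 ≤ Real.log n := Real.log_nonneg (by linarith)
  have hm₁ : C₁ * n * Real.log n ≤ m := le_trans (by gcongr; exact le_max_left _ _) hm
  have hm₂ : C₂ * n * Real.log n ≤ m := le_trans (by gcongr; exact le_max_right _ _) hm
  obtain ⟨hm5, hs⟩ := hlog n m hn hm₂
  have hm5' : (5 : ℝ) ≤ m := by exact_mod_cast hm5
  have hm0 : (0 : ℝ) < m := by linarith
  set s := min ((m : ℝ) / n) √m with hsdef
  have hs0 : 0 < s := lt_min (by positivity) (Real.sqrt_pos.2 hm0)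
  have hsn : s * n ≤ m := (le_div_iff₀ hn0).1 (min_le_left _ _)
  have hss : s * s ≤ m := by
    have := min_le_right ((m : ℝ) / n) √m
    calc s * s ≤ √m * √m := by gcongr
      _ = m := Real.mul_self_sqrt hm0.le
  have hsm : s ≤ m := by nlinarith
  have hB : 0 < s / 1280 := by positivity
  have hsub : {a : Fin m → Fin n → ℂ | ¬ ∀ z : EuclideanSpace ℝ (Fin n), ‖z - x‖ ≤ 1 / 24 →
          ∀ w : EuclideanSpace ℝ (Fin n), ‖w‖ = 1 → 0 ≤ hessianSum a x z w} ⊆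
      {a | ¬ ∀ z : EuclideanSpace ℝ (Fin n), ‖z - x‖ ≤ 1 / 24 →
          ∀ w : EuclideanSpace ℝ (Fin n), ‖w‖ = 1 →
            ∑ r, truncDeficit 100 x z w (a r) ≤ -(1 / 2 * m)} ∪
      {a | ¬ ∀ w : EuclideanSpace ℝ (Fin n), ‖w‖ = 1 →
        ∑ r, excess 100 (sample (a r) x) * ‖sample (a r) w‖ ^ 2 ≤ 2 / 5 * m} := by
    intro a ha
    by_contra hcon
    simp only [Set.mem_union, Set.mem_ofPred_eq, not_or, not_not] at hcon
    exact ha fun z hz w hw => hessianSum_nonneg_of_le (hcon.1 z hz w hw) (hcon.2 w hw)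
  have e1 : Real.exp (-(m * n)) ≤ Real.exp (-(g * s)) := by
    rw [Real.exp_le_exp]
    have : (m : ℝ) * 1 ≤ m * n := by gcongr; linarith
    nlinarith
  have e2 : Real.exp (-(c * m)) ≤ Real.exp (-(g * s)) := by
    rw [Real.exp_le_exp, neg_le_neg_iff]; gcongr
  have e3 : Real.exp (-(s / 1280 / 2)) ≤ Real.exp (-(g * s)) := by
    rw [Real.exp_le_exp]; nlinarith
  have e4 : 5 ^ n * Real.exp (-(m / (160 * (s / 1280)))) ≤ Real.exp (-(g * s)) := by
    have h5 : (5 : ℝ) ≤ Real.exp 2 := by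
      have := Real.exp_one_gt_d9
      have h : Real.exp 2 = Real.exp 1 * Real.exp 1 := by rw [← Real.exp_add]; norm_num
      rw [h]; nlinarith
    have h6 : (n : ℝ) * 2 + g * s ≤ m / (160 * (s / 1280)) := by
      rw [le_div_iff₀ (by positivity)]
      nlinarith
    calc 5 ^ n * Real.exp (-(m / (160 * (s / 1280))))
        ≤ Real.exp 2 ^ n * Real.exp (-(m / (160 * (s / 1280)))) := by gcongr
      _ = Real.exp (n * 2 - m / (160 * (s / 1280))) := by
        rw [← Real.exp_nat_mul, ← Real.exp_add]; ring_nf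
      _ ≤ _ := by rw [Real.exp_le_exp]; linarith
  -- The number of samples, which enters through the cap, is absorbed into half of the exponent.
  have e5 : 5 * (m : ℝ) ≤ Real.exp (g / 2 * s) := by
    have h7 : 4 / g * Real.log m * (g / 2) ≤ s * (g / 2) := by gcongr
    have h8 : 4 / g * Real.log m * (g / 2) = Real.log (m ^ 2) := by
      rw [Real.log_pow]; field_simp; ring
    calc 5 * (m : ℝ) ≤ m ^ 2 := by nlinarith
      _ = Real.exp (Real.log (m ^ 2)) := (Real.exp_log (by positivity)).symm
      _ ≤ _ := by rw [Real.exp_le_exp, ← h8]; linarith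
  have hexc := measureReal_excess_uniform_le m hB hx
  calc _ ≤ (Real.exp (-(m * n)) + Real.exp (-(c * m))) +
        (m * (Real.exp (-(s / 1280 / 2)) * 2) + 5 ^ n * Real.exp (-(m / (160 * (s / 1280))))) :=
        (measureReal_mono hsub).trans ((measureReal_union_le _ _).trans
          (add_le_add (hdef n m hn hm₁ x hx) hexc))
    _ ≤ (Real.exp (-(g * s)) + Real.exp (-(g * s))) +
        (m * (Real.exp (-(g * s)) * 2) + Real.exp (-(g * s))) := by gcongr
    _ = (3 + 2 * m) * Real.exp (-(g * s)) := by ring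
    _ ≤ 5 * m * Real.exp (-(g * s)) := by gcongr; linarith
    _ ≤ Real.exp (g / 2 * s) * Real.exp (-(g * s)) := by gcongr
    _ = _ := by rw [← Real.exp_add]; ring_nf

theorem hessianSum_neg {m : ℕ} (a : Fin m → Fin n → ℂ) (x z w : EuclideanSpace ℝ (Fin n)) :
    hessianSum a x (-z) w = hessianSum a x z w := by
  have h : ∀ r, sample (a r) (-z) = -sample (a r) z := fun r => by simp [sample]
  simp only [hessianSum, h, norm_neg, neg_mul, Complex.neg_re, neg_sq]

theorem hessianSum_smul {m : ℕ} (a : Fin m → Fin n → ℂ) (t : ℝ)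
    (x z w : EuclideanSpace ℝ (Fin n)) :
    hessianSum a (t • x) (t • z) w = t ^ 2 * hessianSum a x z w := by
  simp only [hessianSum, Finset.mul_sum, sample_smul, norm_smul, mul_pow, Real.norm_eq_abs, sq_abs,
    smul_mul_assoc, Complex.smul_re, smul_eq_mul]
  exact Finset.sum_congr rfl fun r _ => by ring

/-- By homogeneity and evenness it suffices to treat a unit signal `x` and `z` near `x`. -/
theorem hessianSum_nonneg_of_unit {m : ℕ} {a : Fin m → Fin n → ℂ}
    {x : EuclideanSpace ℝ (Fin n)} (hx : x ≠ 0)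
    (h : ∀ z : EuclideanSpace ℝ (Fin n), ‖z - ‖x‖⁻¹ • x‖ ≤ 1 / 24 →
      ∀ w : EuclideanSpace ℝ (Fin n), ‖w‖ = 1 → 0 ≤ hessianSum a (‖x‖⁻¹ • x) z w)
    {z w : EuclideanSpace ℝ (Fin n)} (hz : signDist z x ≤ ‖x‖ / 24) (hw : ‖w‖ = 1) :
    0 ≤ hessianSum a x z w := by
  have hx0 : 0 < ‖x‖ := norm_pos_iff.2 hx
  have key : ∀ z : EuclideanSpace ℝ (Fin n), ‖z - x‖ ≤ ‖x‖ / 24 → 0 ≤ hessianSum a x z w := by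
    intro z hz
    have h1 := h (‖x‖⁻¹ • z) (by
      rw [← smul_sub, norm_smul, norm_inv, norm_norm, inv_mul_le_iff₀ hx0]
      linarith) w hw
    rw [hessianSum_smul] at h1
    exact nonneg_of_mul_nonneg_right h1 (by positivity)
  rcases min_le_iff.1 hz with h1 | h1
  · exact key z h1
  · rw [← hessianSum_neg]
    refine key _ ?_
    rwa [← norm_neg, neg_sub, sub_neg_eq_add, add_comm]

/-- In dimension one all samples of real signals have the same phase, and the Hessian is
deterministically nonnegative near the solutions. -/
theorem hessianSum_nonneg_of_dim_one {m : ℕ} (a : Fin m → Fin 1 → ℂ)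
    {x z : EuclideanSpace ℝ (Fin 1)} (w : EuclideanSpace ℝ (Fin 1)) (hz : ‖z - x‖ ≤ 1 / 24)
    (hx : ‖x‖ = 1) : 0 ≤ hessianSum a x z w := by
  have hn : ∀ y : EuclideanSpace ℝ (Fin 1), ‖y‖ ^ 2 = y 0 ^ 2 := fun y => by
    simp [EuclideanSpace.norm_sq_eq]
  have hz2 : 23 / 24 ≤ ‖z‖ := by
    have := norm_le_norm_add_norm_sub z x
    linarith
  have hzz : (23 / 24 : ℝ) ^ 2 ≤ ‖z‖ ^ 2 := by gcongr
  have hxx : x 0 ^ 2 = 1 := by rw [← hn, hx, one_pow]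
  rw [hn] at hzz
  refine Finset.sum_nonneg fun r _ => ?_
  have e : (‖sample (a r) z‖ ^ 2 - ‖sample (a r) x‖ ^ 2) * ‖sample (a r) w‖ ^ 2 +
      2 * (sample (a r) z * conj (sample (a r) w)).re ^ 2 =
      (3 * z 0 ^ 2 - x 0 ^ 2) * (w 0 ^ 2 * (‖a r 0‖ ^ 2) ^ 2) := by
    simp only [sample, Finset.univ_unique, Fin.default_eq_zero, Finset.sum_singleton,
      ← Complex.normSq_eq_norm_sq, Complex.normSq_apply, Complex.mul_re, Complex.mul_im,
      Complex.conj_re, Complex.conj_im, Complex.ofReal_re, Complex.ofReal_im]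
    simp
    ring
  rw [e, hxx]
  have : 0 ≤ 3 * z 0 ^ 2 - 1 := by norm_num at hzz; linarith
  positivity

/-! ### Convexity of the cost -/

/-- A cost whose Hessian is nonnegative on a convex set is convex there: restrict to segments. -/
theorem convexOn_cost {m : ℕ} {a : Fin m → Fin n → ℂ} {y : Fin m → ℝ}
    {S : Set (EuclideanSpace ℝ (Fin n))} (hS : Convex ℝ S)
    (h : ∀ z ∈ S, ∀ w : EuclideanSpace ℝ (Fin n), ‖w‖ = 1 →
      0 ≤ (w : Fin n → ℝ) ⬝ᵥ (hessian a y z *ᵥ (w : Fin n → ℝ))) :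
    ConvexOn ℝ S (cost a y) := by
  have hgen : ∀ z ∈ S, ∀ w : EuclideanSpace ℝ (Fin n),
      0 ≤ (w : Fin n → ℝ) ⬝ᵥ (hessian a y z *ᵥ (w : Fin n → ℝ)) := by
    intro z hz w
    rcases eq_or_ne w 0 with rfl | hw
    · simp
    have hw0 : 0 < ‖w‖ := norm_pos_iff.2 hw
    have h1 := h z hz (‖w‖⁻¹ • w) (by rw [norm_smul, norm_inv, norm_norm, inv_mul_cancel₀ hw0.ne'])
    rw [WithLp.ofLp_smul, Matrix.mulVec_smul, smul_dotProduct, dotProduct_smul, smul_smul,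
      smul_eq_mul] at h1
    exact nonneg_of_mul_nonneg_right h1 (by positivity)
  refine ⟨hS, fun p hp q hq s t hs ht hst => ?_⟩
  have hcont : ContDiff ℝ 2 (fun τ : ℝ => cost a y (p + τ • (q - p))) := by
    have hlin : ∀ (r : Fin m) (τ : ℝ), sample (a r) (p + τ • (q - p)) =
        sample (a r) p + τ • sample (a r) (q - p) := fun r τ => by
      rw [sample_add, sample_smul]
    unfold cost
    simp_rw [hlin, ← Complex.normSq_eq_norm_sq, Complex.normSq_apply, Complex.add_re,
      Complex.add_im, Complex.smul_re, Complex.smul_im, smul_eq_mul]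
    fun_prop
  have hmem : ∀ τ ∈ Set.Icc (0 : ℝ) 1, p + τ • (q - p) ∈ S := fun τ hτ =>
    hS.add_smul_sub_mem hp hq hτ
  have hconv : ConvexOn ℝ (Set.Icc (0 : ℝ) 1) (fun τ : ℝ => cost a y (p + τ • (q - p))) := by
    refine convexOn_of_deriv2_nonneg' (convex_Icc 0 1)
      (hcont.differentiable (by norm_num)).differentiableOn
      ((hcont.differentiable_deriv_two).differentiableOn) fun τ hτ => ?_
    have h2 := iteratedDeriv_two_cost a y (p + τ • (q - p)) (q - p)
    have h3 : (fun u : ℝ => cost a y (p + τ • (q - p) + u • (q - p))) =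
        fun u => (fun τ : ℝ => cost a y (p + τ • (q - p))) (τ + u) := by
      funext u
      simp only [add_smul, add_assoc]
    rw [h3, iteratedDeriv_comp_const_add 2 (fun τ : ℝ => cost a y (p + τ • (q - p))) τ] at h2
    simp only [add_zero] at h2
    rw [← iteratedDeriv_eq_iterate, h2]
    have := hgen _ (hmem τ hτ) (q - p)
    positivity
  have h4 := hconv.2 (Set.left_mem_Icc.2 zero_le_one) (Set.right_mem_Icc.2 zero_le_one) hs ht hst
  simp only [smul_eq_mul, mul_zero, mul_one, zero_add, zero_smul, add_zero, one_smul,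
    add_sub_cancel] at h4
  have h5 : s • p + t • q = p + t • (q - p) := by
    rw [← eq_sub_iff_add_eq] at hst
    rw [hst, sub_smul, one_smul, smul_sub]; abel
  rw [h5]
  exact h4

end PhaseRetrieval

end

theorem theorem3 :
    ∃ C : ℝ, 0 < C ∧ ∃ γ : ℝ, 0 < γ ∧
      ∀ m n : ℕ, 0 < m → 0 < n → C * n * Real.log n ≤ m →
      ∃ α : ℝ, α = γ * min ((m : ℝ) / n ^ 2) (√(m : ℝ) / n) ∧
      ∀ (Ω : Type*) [MeasurableSpace Ω] (P : Measure Ω) [IsProbabilityMeasure P]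
        (a : Fin m → Ω → Fin n → ℂ), PhaseRetrieval.IsGaussianModel a P →
      ∀ x : EuclideanSpace ℝ (Fin n),
        1 - Real.exp (-(α * n)) ≤ P.real {ω |
          (∀ z : EuclideanSpace ℝ (Fin n), PhaseRetrieval.signDist z x ≤ ‖x‖ / 24 →
            ∀ w : EuclideanSpace ℝ (Fin n), ‖w‖ = 1 →
              0 ≤ (w : Fin n → ℝ) ⬝ᵥ
                (PhaseRetrieval.hessian (fun r => a r ω)
                  (PhaseRetrieval.intensity (fun r => a r ω) x) z *ᵥ (w : Fin n → ℝ))) ∧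
          ∀ c ∈ ({x, -x} : Set (EuclideanSpace ℝ (Fin n))),
            ConvexOn ℝ (Metric.closedBall c (‖x‖ / 24))
              (PhaseRetrieval.cost (fun r => a r ω)
                (PhaseRetrieval.intensity (fun r => a r ω) x))} := by
  obtain ⟨C, hC, γ, hγ, hmain⟩ := PhaseRetrieval.exists_measureReal_hessianSum_neg_le
  refine ⟨C, hC, γ, hγ, fun m n hm hn hmn => ⟨_, rfl, ?_⟩⟩
  intro Ω _ P _ a ha x
  have hn0 : (0 : ℝ) < n := by exact_mod_cast hn
  -- The second half of the event follows from the first, which is a statement about `hessianSum`.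
  have hsub : {ω | ∀ z : EuclideanSpace ℝ (Fin n), PhaseRetrieval.signDist z x ≤ ‖x‖ / 24 →
      ∀ w : EuclideanSpace ℝ (Fin n), ‖w‖ = 1 →
        0 ≤ PhaseRetrieval.hessianSum (fun r => a r ω) x z w} ⊆ {ω |
          (∀ z : EuclideanSpace ℝ (Fin n), PhaseRetrieval.signDist z x ≤ ‖x‖ / 24 →
            ∀ w : EuclideanSpace ℝ (Fin n), ‖w‖ = 1 →
              0 ≤ (w : Fin n → ℝ) ⬝ᵥ
                (PhaseRetrieval.hessian (fun r => a r ω)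
                  (PhaseRetrieval.intensity (fun r => a r ω) x) z *ᵥ (w : Fin n → ℝ))) ∧
          ∀ c ∈ ({x, -x} : Set (EuclideanSpace ℝ (Fin n))),
            ConvexOn ℝ (Metric.closedBall c (‖x‖ / 24))
              (PhaseRetrieval.cost (fun r => a r ω)
                (PhaseRetrieval.intensity (fun r => a r ω) x))} := by
    intro ω hω
    have hH : ∀ z : EuclideanSpace ℝ (Fin n), PhaseRetrieval.signDist z x ≤ ‖x‖ / 24 →
        ∀ w : EuclideanSpace ℝ (Fin n), ‖w‖ = 1 →
          0 ≤ (w : Fin n → ℝ) ⬝ᵥ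
            (PhaseRetrieval.hessian (fun r => a r ω)
              (PhaseRetrieval.intensity (fun r => a r ω) x) z *ᵥ (w : Fin n → ℝ)) := by
      intro z hz w hw
      rw [PhaseRetrieval.quadForm_hessian_intensity]
      exact mul_nonneg (by positivity) (hω z hz w hw)
    refine ⟨hH, fun c hc => PhaseRetrieval.convexOn_cost (convex_closedBall _ _)
      fun z hz => hH z ?_⟩
    rw [mem_closedBall_iff_norm] at hz
    rcases hc with rfl | rfl
    · exact (min_le_left _ _).trans hz
    · exact (min_le_right _ _).trans (by rwa [sub_neg_eq_add] at hz)
  refine le_trans ?_ (measureReal_mono hsub)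
  set G := {ω | ∀ z : EuclideanSpace ℝ (Fin n), PhaseRetrieval.signDist z x ≤ ‖x‖ / 24 →
      ∀ w : EuclideanSpace ℝ (Fin n), ‖w‖ = 1 →
        0 ≤ PhaseRetrieval.hessianSum (fun r => a r ω) x z w} with hG
  have hone : G = Set.univ → 1 - Real.exp (-(γ * min ((m : ℝ) / n ^ 2) (√(m : ℝ) / n) * n)) ≤
      P.real G := by
    intro h
    rw [h, probReal_univ]
    linarith [Real.exp_pos (-(γ * min ((m : ℝ) / n ^ 2) (√(m : ℝ) / n) * n))]
  rcases eq_or_ne x 0 with rfl | hx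
  · refine hone (Set.eq_univ_of_forall fun ω z hz w hw => ?_)
    have hz0 : z = 0 := by simpa [PhaseRetrieval.signDist] using hz
    simp [hz0, PhaseRetrieval.hessianSum, PhaseRetrieval.sample]
  have hx1 : ‖‖x‖⁻¹ • x‖ = 1 := by
    rw [norm_smul, norm_inv, norm_norm, inv_mul_cancel₀ (norm_ne_zero_iff.2 hx)]
  rcases Nat.lt_or_ge n 2 with h2 | h2
  · obtain rfl : n = 1 := by omega
    exact hone (Set.eq_univ_of_forall fun ω z hz w hw =>
      PhaseRetrieval.hessianSum_nonneg_of_unit hx (fun z' hz' w' _ =>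
        PhaseRetrieval.hessianSum_nonneg_of_dim_one _ w' hz' hx1) hz hw)
  have hexp : γ * min ((m : ℝ) / n ^ 2) (√(m : ℝ) / n) * n = γ * min ((m : ℝ) / n) √m := by
    rw [mul_assoc, min_mul_of_nonneg _ _ hn0.le]
    congr 2
    · field_simp
    · field_simp
  rw [hexp]
  have hbad := hmain n m h2 hmn _ hx1
  have hlaw : P.map (fun ω r => a r ω) =
      Measure.pi fun _ : Fin m => PhaseRetrieval.complexGaussianVector n := by
    rw [(iIndepFun_iff_map_fun_eq_pi_map fun r => (ha.law r).aemeasurable).1 ha.indep]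
    congr 1
    funext r
    exact (ha.law r).map_eq
  have hcompl : P.real Gᶜ ≤ Real.exp (-(γ * min ((m : ℝ) / n) √m)) := by
    refine le_trans ?_ hbad
    rw [← hlaw]
    have : IsProbabilityMeasure (P.map fun ω r => a r ω) := by
      rw [hlaw]; infer_instance
    refine (ENNReal.toReal_mono (measure_ne_top _ _) (measure_mono ?_)).trans
      (ENNReal.toReal_mono (measure_ne_top _ _) (Measure.le_map_apply
        (aemeasurable_pi_lambda _ fun r => (ha.law r).aemeasurable) _))
    intro ω hω hgood
    exact hω fun z hz w hw => PhaseRetrieval.hessianSum_nonneg_of_unit hx hgood hz hw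
  have hcover : 1 ≤ P.real G + P.real Gᶜ := by
    rw [← probReal_univ (μ := P), ← Set.union_compl_self G]
    exact measureReal_union_le _ _
  linarith
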